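/- Let $n\ge 8$ and $m=n-4$. Let $\mathrm{B}_n$ be the Coxeter group of type $\mathrm{B}_n$, realised as the subgroup of $\mathrm{Sym}(\{1,\ldots,2n\})$ generated by its simple reflections $\beta_0=(1,n+1)$ and $\beta_j=(j,j+1)(n+j,n+j+1)$ for $1\le j\le n-1$; that is, the assignment of the simple reflections to the $\beta_j$ in the order of the Coxeter diagram (the edge labelled $4$ joining $\beta_0$ and $\beta_1$) extends to an injective homomorphism $\mathrm{B}_n\to\mathrm{Sym}(\{1,\ldots,2n\})$. (Reading $n+i$ as $-i$, these are signed permutations.) A *C-string of rank $m$* for a group $G$ is a set of $m$ involutions $\{t_1,\ldots,t_m\}$, in this order, such that $G=\langle t_1,\ldots,t_m\rangle$, such that $t_i$ and $t_j$ commute whenever $|i-j|\ge 2$, and such that $G_J\cap G_K=G_{J\cap K}$ for all $J,K\subseteq\{1,\ldots,m\}$, where $G_J=\langle t_j\mid j\in J\rangle$. Its *Schläfli symbol* is the sequence of the orders of $t_1t_2,\,t_2t_3,\ldots,t_{m-1}t_m$. A C-string for $G$ is *unravelled* if, for every normal subgroup $N$ of $G$ with $1\ne N\ne G$, the images $\overline{t_1},\ldots,\overline{t_m}$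 in $G/N$ are either not pairwise distinct, or are pairwise distinct but do not form a C-string for $G/N$. Then the permutations $$t_1=(2,3)(n+2,n+3)(4,5)(n+4,n+5)\prod_{i=6}^n(i,n+i),$$ $$t_2=(1,2)(n+1,n+2)(3,4)(n+3,n+4)(5,6)(n+5,n+6)\prod_{i=7}^n(i,n+i),$$ $$t_3=(2,3)(n+2,n+3)(6,7)(n+6,n+7),$$ $$t_k=(k+3,k+4)(n+k+3,n+k+4)\qquad(4\le k\le m)$$ lie in $\mathrm{B}_n$, and $\{t_1,\ldots,t_m\}$ is a C-string of rank $m$ for $\mathrm{B}_n$ with Schläfli symbol $[12,12,6,3,\ldots,3]$, in which the entry $3$ occurs $n-8$ times. Moreover, when $n$ is even, this C-string is unravelled. -/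

import Mathlib

/-! ### C-strings -/

/-- `t 0, …, t (m-1)` is a C-string of rank `m` for the group `G`: the `t i` are `m` distinct
involutions generating `G`, `t i` and `t j` commute whenever `|i - j| ≥ 2`, and, writing `G_J` for
the subgroup generated by the `t j` with `j ∈ J`, `G_J ∩ G_K = G_{J ∩ K}` for all sets of indices
`J` and `K`. -/
structure IsCString {G : Type*} [Group G] {m : ℕ} (t : Fin m → G) : Prop where
  injective : Function.Injective t
  involution : ∀ i, orderOf (t i) = 2
  generate : Subgroup.closure (Set.range t) = ⊤
  string : ∀ i j : Fin m, (i : ℕ) + 2 ≤ j → Commute (t i) (t j)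
  intersection : ∀ J K : Set (Fin m),
    Subgroup.closure (t '' J) ⊓ Subgroup.closure (t '' K) = Subgroup.closure (t '' (J ∩ K))

/-- The C-string `t` for `G` is `N`-unravelled: either the images of the `t i` in `G ⧸ N` are not
pairwise distinct, or they are pairwise distinct but do not form a C-string for `G ⧸ N`. -/
def IsUnravelledAt {G : Type*} [Group G] {m : ℕ} (t : Fin m → G)
    (N : Subgroup G) [N.Normal] : Prop :=
  ¬ Function.Injective (fun i => (t i : G ⧸ N)) ∨
    (Function.Injective (fun i => (t i : G ⧸ N)) ∧ ¬ IsCString (fun i => (t i : G ⧸ N)))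

/-- `t` is an unravelled C-string for `G`: it is a C-string for `G` which is `N`-unravelled for
every non-trivial proper normal subgroup `N` of `G`. -/
def IsUnravelledCString {G : Type*} [Group G] {m : ℕ} (t : Fin m → G) : Prop :=
  IsCString t ∧
    ∀ (N : Subgroup G) [N.Normal], N ≠ ⊥ → N ≠ ⊤ → IsUnravelledAt t N

/-- The Schläfli symbol of `t`: the list of the orders of the products of consecutive members. -/
noncomputable def schlafliSymbol {G : Type*} [Group G] {m : ℕ} (t : Fin m → G) : List ℕ :=
  List.ofFn fun i : Fin (m - 1) => orderOf (t ⟨i, by omega⟩ * t ⟨i + 1, by omega⟩)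

/-! ### Permutations of `Ω = {1, …, 2n}`

`Ω` is modelled by `Fin n ⊕ Fin n`. Points are numbered from `1` as on paper: the point `k` with
`1 ≤ k ≤ n` is `Sum.inl (pt k)`, and the point `n + k` is `Sum.inr (pt k)`. Reading `n + k` as
`-k`, the permutations below are signed permutations of `{±1, …, ±n}`. -/

/-- The index `k`, where `1 ≤ k ≤ n`. -/
def pt {n : ℕ} (k : ℕ) (h : 1 ≤ k ∧ k ≤ n := by omega) : Fin n :=
  ⟨k - 1, by omega⟩

/-- The permutation `(a, b)(n + a, n + b)`. -/
def dswap {n : ℕ} (a b : Fin n) : Equiv.Perm (Fin n ⊕ Fin n) :=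
  Equiv.swap (Sum.inl a) (Sum.inl b) * Equiv.swap (Sum.inr a) (Sum.inr b)

/-- The permutation `∏_{i=k}^{n} (i, n + i)`. -/
def negFrom (n k : ℕ) : Equiv.Perm (Fin n ⊕ Fin n) where
  toFun x := if k ≤ (Sum.elim id id x : Fin n).val + 1 then x.swap else x
  invFun x := if k ≤ (Sum.elim id id x : Fin n).val + 1 then x.swap else x
  left_inv x := by
    rcases x with x | x <;> by_cases h : k ≤ (x : ℕ) + 1 <;> simp [h]
  right_inv x := by
    rcases x with x | x <;> by_cases h : k ≤ (x : ℕ) + 1 <;> simp [h]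

/-- The permutations `β_0 = (1, n + 1)` and `β_j = (j, j + 1)(n + j, n + j + 1)` for
`1 ≤ j ≤ n - 1`. -/
def betaPerm {n : ℕ} (j : Fin n) : Equiv.Perm (Fin n ⊕ Fin n) :=
  if h : (j : ℕ) = 0 then Equiv.swap (Sum.inl j) (Sum.inr j)
  else dswap (pt (j : ℕ)) (pt ((j : ℕ) + 1))

/-- The permutations `t_1, …, t_m` of `Ω`, where `n ≥ 8` and `m = n - 4`; the index `i : Fin (n-4)`
stands for `t_{i+1}`:
* `t_1 = (2,3)(n+2,n+3)(4,5)(n+4,n+5) ∏_{i=6}^n (i,n+i)`,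
* `t_2 = (1,2)(n+1,n+2)(3,4)(n+3,n+4)(5,6)(n+5,n+6) ∏_{i=7}^n (i,n+i)`,
* `t_3 = (2,3)(n+2,n+3)(6,7)(n+6,n+7)`,
* `t_k = (k+3,k+4)(n+k+3,n+k+4)` for `4 ≤ k ≤ m`. -/
def tPerm (n : ℕ) (hn : 8 ≤ n) (i : Fin (n - 4)) : Equiv.Perm (Fin n ⊕ Fin n) :=
  if (i : ℕ) + 1 = 1 then dswap (pt 2) (pt 3) * dswap (pt 4) (pt 5) * negFrom n 6
  else if (i : ℕ) + 1 = 2 then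
    dswap (pt 1) (pt 2) * dswap (pt 3) (pt 4) * dswap (pt 5) (pt 6) * negFrom n 7
  else if (i : ℕ) + 1 = 3 then dswap (pt 2) (pt 3) * dswap (pt 6) (pt 7)
  else dswap (pt ((i : ℕ) + 1 + 3)) (pt ((i : ℕ) + 1 + 4))

/-! ### The intersection property for string-generated groups -/

section StringGroups

variable {G : Type*} [Group G]

/-! The Coxeter group is identified with the signed permutations (`signedRep_injective`), and
everything is computed there after conjugation by the sign change of coordinate 5 (coordinates and
generators are numbered from 1 in this comment, from 0 in the code below). Conjugation turns t_2
into X·(5,6), where X is (1,2)(3,4) together with the sign changes of all coordinates from 5 on; so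
X commutes with every unsigned permutation of {5,…,n}.

As t_3t_4 is (2,3) times a commuting 3-cycle, (t_3t_4)^3 = (2,3). Hence a string containing t_3 and
t_4 splits t_3 into (2,3) and (6,7); if it also contains t_2, then (t_2·(6,7))^3 = X splits t_2. So
⟨t_2,…,t_b⟩ with b ≥ 4 is generated by X, (2,3) and a symmetric group commuting with both, and
adding t_1 to the full string gives all signed permutations (`signedPerms_le_genSpan`).

For the intersection property it is enough to compare ⟨t_a,…,t_{b-1}⟩ with ⟨t_{a+1},…,t_b⟩
(`closure_image_inf_le_of_closure_Ico`). Elements of the first group preserve the axis of the last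
coordinate moved by t_b, so the symmetric part of a common element loses that coordinate. In short
strings the splitting fails; there ⟨t_1,t_2⟩ and ⟨t_2,t_3⟩ are compared as dihedral groups, and the
rest follows because t_1, t_2, t_3 act on the first seven coordinates with determinant 1, so that no
single transposition of these lies in ⟨t_1,t_2,t_3⟩.

For n even, every non-trivial normal subgroup N contains -1 (`sumComm_mem_of_normal`). Some word in
t_1, t_2, t_3 equals -(2,3) (`blockGen_word`), so modulo N the element (2,3) = (t_3t_4)^3 lies in
the images of both ⟨t_1,t_2,t_3⟩ and ⟨t_3,t_4⟩. Were the quotient string a C-string, (2,3) would lie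
in the image of ⟨t_3⟩, so N would contain (2,3) or (6,7), hence every transposition, hence t_4,
whose image would not be an involution. -/

theorem exists_mul_of_mem_sup_of_commute {H K : Subgroup G}
    (hc : ∀ h ∈ H, ∀ k ∈ K, Commute h k) {x : G} (hx : x ∈ H ⊔ K) :
    ∃ h ∈ H, ∃ k ∈ K, h * k = x := by
  have hr := MonoidHom.noncommCoprod_range H.subtype K.subtype
    (fun h k => hc h h.2 k k.2)
  rw [H.range_subtype, K.range_subtype] at hr
  rw [← hr] at hx
  obtain ⟨⟨h, k⟩, rfl⟩ := hx
  exact ⟨h, h.2, k, k.2, rfl⟩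

theorem commute_of_mem_closure {S T : Set G} (hc : ∀ s ∈ S, ∀ t ∈ T, Commute s t)
    {x y : G} (hx : x ∈ Subgroup.closure S) (hy : y ∈ Subgroup.closure T) : Commute x y := by
  have h1 : ∀ s ∈ S, Commute s y := fun s hs => by
    have : Subgroup.closure T ≤ Subgroup.centralizer {s} := by
      rw [Subgroup.closure_le]
      intro t ht
      rw [SetLike.mem_coe, Subgroup.mem_centralizer_singleton_iff]
      exact (hc s hs t ht).symm
    exact (Subgroup.mem_centralizer_singleton_iff.1 (this hy)).symm
  have : Subgroup.closure S ≤ Subgroup.centralizer {y} := by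
    rw [Subgroup.closure_le]
    intro s hs
    rw [SetLike.mem_coe, Subgroup.mem_centralizer_singleton_iff]
    exact h1 s hs
  exact Subgroup.mem_centralizer_singleton_iff.1 (this hx)

variable {T : ℕ → G} {m : ℕ}

/-- The endpoints are moved one at a time: an induction on `b` removes the right overhang by means
of `hT`, then an induction on `i - a` moves the left endpoint. Thus only intervals shifted by one
place have to be compared. -/
theorem closure_Ico_inf_closure_Ico_le
    (hT : ∀ a b, a < b → b < m →
      Subgroup.closure (T '' Set.Ico a b) ⊓ Subgroup.closure (T '' Set.Ico (a + 1) (b + 1)) ≤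
        Subgroup.closure (T '' Set.Ico (a + 1) b))
    {a i j b : ℕ} (hai : a ≤ i) (hij : i ≤ j) (hjb : j ≤ b) (hb : b ≤ m) :
    Subgroup.closure (T '' Set.Ico a j) ⊓ Subgroup.closure (T '' Set.Ico (i + 1) b) ≤
      Subgroup.closure (T '' Set.Ico (i + 1) j) := by
  have mono : ∀ {a b c d : ℕ}, c ≤ a → b ≤ d →
      Subgroup.closure (T '' Set.Ico a b) ≤ Subgroup.closure (T '' Set.Ico c d) :=
    fun h1 h2 => Subgroup.closure_mono (Set.image_mono (Set.Ico_subset_Ico h1 h2))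
  have step : ∀ a k b, a < k → k ≤ b → b ≤ m →
      Subgroup.closure (T '' Set.Ico a k) ⊓ Subgroup.closure (T '' Set.Ico (a + 1) b) ≤
        Subgroup.closure (T '' Set.Ico (a + 1) k) := by
    intro a k b hak hkb
    induction b, hkb using Nat.le_induction with
    | base => exact fun _ => inf_le_right
    | succ b hkb ih =>
      intro hb g hg
      exact ih (by omega)
        ⟨hg.1, hT a b (by omega) (by omega) ⟨mono le_rfl hkb hg.1, hg.2⟩⟩
  obtain ⟨d, rfl⟩ := Nat.exists_eq_add_of_le hai
  induction d generalizing a with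
  | zero =>
    rcases hij.eq_or_lt with h | h
    · subst h
      simp
    · exact step a j b (by omega) hjb hb
  | succ d ih =>
    intro g hg
    have h1 := step a j b (by omega) hjb hb ⟨hg.1, mono (by omega) le_rfl hg.2⟩
    have h2 := ih (a := a + 1) (by omega) (by omega)
    rw [show a + 1 + d = a + (d + 1) by omega] at h2
    exact h2 ⟨h1, hg.2⟩

/-- Induction on the length of the ambient interval. An index missing from `J` or from `K` cuts the
corresponding group into two commuting factors; the two factorisations of a common element are
compared across the gaps by the interval case. -/
theorem closure_image_inf_le_of_closure_Ico
    (hcomm : ∀ i j, i + 2 ≤ j → Commute (T i) (T j))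
    (hT : ∀ a b, a < b → b < m →
      Subgroup.closure (T '' Set.Ico a b) ⊓ Subgroup.closure (T '' Set.Ico (a + 1) (b + 1)) ≤
        Subgroup.closure (T '' Set.Ico (a + 1) b))
    (l a b : ℕ) (hb : b ≤ m) (hl : b ≤ a + l) (J K : Set ℕ) (hJ : J ⊆ Set.Ico a b)
    (hK : K ⊆ Set.Ico a b) :
    Subgroup.closure (T '' J) ⊓ Subgroup.closure (T '' K) ≤ Subgroup.closure (T '' (J ∩ K)) := by
  induction l generalizing a b J K with
  | zero =>
    have : J = ∅ := by
      rw [Set.Ico_eq_empty (by omega)] at hJ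
      exact Set.subset_empty_iff.1 hJ
    subst this
    simp
  | succ l ih =>
    have split : ∀ (c d k : ℕ) (L : Set ℕ), k ∉ L → L ⊆ Set.Ico c d →
        ∀ g ∈ Subgroup.closure (T '' L), ∃ x ∈ Subgroup.closure (T '' (L ∩ Set.Ico c k)),
          ∃ y ∈ Subgroup.closure (T '' (L ∩ Set.Ico (k + 1) d)), x * y = g := by
      intro c d k L hk hL g hg
      apply exists_mul_of_mem_sup_of_commute
      · intro x hx y hy
        refine commute_of_mem_closure ?_ hx hy
        rintro _ ⟨p, ⟨-, hp⟩, rfl⟩ _ ⟨q, ⟨-, hq⟩, rfl⟩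
        exact hcomm p q (by have := hp.2; have := hq.1; omega)
      · rw [← Subgroup.closure_union, ← Set.image_union, ← Set.inter_union_distrib_left]
        convert hg using 3
        refine Set.inter_eq_left.2 fun p hp => ?_
        have h1 := hL hp
        have : p ≠ k := fun h => hk (h ▸ hp)
        simp only [Set.mem_union, Set.mem_Ico] at h1 ⊢
        omega
    have mono : ∀ {A B : Set ℕ}, A ⊆ B →
        Subgroup.closure (T '' A) ≤ Subgroup.closure (T '' B) :=
      fun h => Subgroup.closure_mono (Set.image_mono h)
    have key : ∀ (J K : Set ℕ) (i j : ℕ), J ⊆ Set.Ico a b → K ⊆ Set.Ico a b → i ∈ Set.Ico a b →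
        j ∈ Set.Ico a b → i ∉ J → j ∉ K → i ≤ j →
        Subgroup.closure (T '' J) ⊓ Subgroup.closure (T '' K) ≤
          Subgroup.closure (T '' (J ∩ K)) := by
      rintro J K i j hJ hK ⟨hai, hib⟩ ⟨haj, hjb⟩ hiJ hjK hij g ⟨hgJ, hgK⟩
      obtain ⟨g₁, hg₁, g₂, hg₂, rfl⟩ := split a b i J hiJ hJ g hgJ
      obtain ⟨h₁, hh₁, h₂, hh₂, heq⟩ := split a b j K hjK hK _ hgK
      -- The discrepancy between the two factorisations: the left side involves only indices below
      -- `j`, the right side only indices above `i`, so it lives strictly between `i` and `j`.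
      have huv : h₁⁻¹ * g₁ = h₂ * g₂⁻¹ := by
        rw [inv_mul_eq_iff_eq_mul, ← mul_assoc, heq, mul_inv_cancel_right]
      have hu : h₁⁻¹ * g₁ ∈ Subgroup.closure (T '' Set.Ico (i + 1) j) := by
        refine closure_Ico_inf_closure_Ico_le hT hai hij hjb.le hb (Subgroup.mem_inf.2 ⟨?_, ?_⟩)
        · refine mul_mem (inv_mem (mono Set.inter_subset_right hh₁)) (mono ?_ hg₁)
          exact Set.inter_subset_right.trans (Set.Ico_subset_Ico le_rfl hij)
        · rw [huv]
          refine mul_mem (mono ?_ hh₂) (inv_mem (mono Set.inter_subset_right hg₂))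
          exact Set.inter_subset_right.trans (Set.Ico_subset_Ico (by omega) le_rfl)
      have hg₂' : g₂ ∈ Subgroup.closure
          (T '' ((J ∩ Set.Ico (i + 1) b) ∩ (Set.Ico (i + 1) b \ {j}))) := by
        refine ih (i + 1) b hb (by omega) _ _ Set.inter_subset_right Set.sdiff_subset
          (Subgroup.mem_inf.2 ⟨hg₂, ?_⟩)
        rw [show g₂ = (h₁⁻¹ * g₁)⁻¹ * h₂ by rw [huv]; group]
        refine mul_mem (inv_mem (mono ?_ hu)) (mono ?_ hh₂)
        · intro p hp
          simp only [Set.mem_Ico, Set.mem_sdiff, Set.mem_singleton_iff] at hp ⊢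
          omega
        · rintro p ⟨-, hp⟩
          simp only [Set.mem_Ico, Set.mem_sdiff, Set.mem_singleton_iff] at hp ⊢
          omega
      obtain ⟨p, hp, q, hq, hpq⟩ := split (i + 1) b j _ (fun h => h.2.2 rfl)
        (fun x hx => hx.1.2) _ hg₂'
      have hq' : q ∈ Subgroup.closure (T '' (J ∩ Set.Ico (j + 1) b)) :=
        mono (fun x hx => And.intro hx.1.1.1 hx.2) hq
      have hp' : p ∈ Subgroup.closure (T '' (J ∩ Set.Ico (i + 1) j)) :=
        mono (fun x hx => And.intro hx.1.1.1 hx.2) hp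
      -- This element involves only indices below `j` and also only indices above `j`; since
      -- `Set.Ico (j + 1) j` is empty, it is trivial. Hence `h₁` and `h₂` can be written in the
      -- generators from `J` as well as from `K`.
      have hone : (h₁⁻¹ * g₁) * p = 1 := by
        have h2 : (h₁⁻¹ * g₁) * p = h₂ * q⁻¹ := by
          rw [huv, ← hpq]; group
        have := closure_Ico_inf_closure_Ico_le hT (a := i) (i := j) (j := j) (b := b)
          hij le_rfl hjb.le hb (Subgroup.mem_inf.2 ⟨mono (Set.Ico_subset_Ico (by omega) le_rfl)
            (mul_mem hu (mono Set.inter_subset_right hp')), by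
            rw [h2]
            exact mul_mem (mono Set.inter_subset_right hh₂)
              (inv_mem (mono Set.inter_subset_right hq'))⟩)
        simpa using this
      have hh₁p : h₁ = g₁ * p := by
        rw [mul_assoc, inv_mul_eq_iff_eq_mul, mul_one] at hone
        exact hone.symm
      have hh₂q : h₂ = q := by
        rw [← hpq, hh₁p] at heq
        simpa [mul_assoc] using heq
      rw [← heq]
      refine mul_mem (mono ?_ (ih a j (by omega) (by omega) (J ∩ Set.Ico a j) (K ∩ Set.Ico a j)
        Set.inter_subset_right Set.inter_subset_right (Subgroup.mem_inf.2 ⟨?_, hh₁⟩)))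
        (mono ?_ (ih (j + 1) b hb (by omega) (J ∩ Set.Ico (j + 1) b) (K ∩ Set.Ico (j + 1) b)
        Set.inter_subset_right Set.inter_subset_right
        (Subgroup.mem_inf.2 ⟨by rw [hh₂q]; exact hq', hh₂⟩)))
      · exact fun x hx => ⟨hx.1.1, hx.2.1⟩
      · rw [hh₁p]
        refine mul_mem (mono ?_ hg₁) (mono ?_ hp')
        · exact Set.inter_subset_inter_right _ (Set.Ico_subset_Ico le_rfl hij)
        · exact Set.inter_subset_inter_right _ (Set.Ico_subset_Ico (by omega) le_rfl)
      · exact fun x hx => ⟨hx.1.1, hx.2.1⟩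
    by_cases hJ' : ∃ i ∈ Set.Ico a b, i ∉ J
    · by_cases hK' : ∃ j ∈ Set.Ico a b, j ∉ K
      · obtain ⟨i, hi, hiJ⟩ := hJ'
        obtain ⟨j, hj, hjK⟩ := hK'
        rcases le_total i j with h | h
        · exact key J K i j hJ hK hi hj hiJ hjK h
        · rw [inf_comm, Set.inter_comm]
          exact key K J j i hK hJ hj hi hjK hiJ h
      · push Not at hK'
        rw [Set.inter_eq_left.2 (hJ.trans hK')]
        exact inf_le_left
    · push Not at hJ'
      rw [Set.inter_eq_right.2 (hK.trans hJ')]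
      exact inf_le_right

end StringGroups

/-! ### Faithfulness of the signed permutation representation -/

section TypeB

variable {G : Type*} [Group G]

/-- The product `s i * s (i + 1) * ⋯ * s (i + l - 1)`. -/
def ascendingProd (s : ℕ → G) : ℕ → ℕ → G
  | _, 0 => 1
  | i, l + 1 => s i * ascendingProd s (i + 1) l

/-- The product `s i * ⋯ * s 1 * s 0 * s 1 * ⋯ * s k`. -/
def valleyProd (s : ℕ → G) (k : ℕ) : ℕ → G
  | 0 => ascendingProd s 0 (k + 1)
  | i + 1 => s (i + 1) * valleyProd s k i

/-- The relations between the simple reflections of a Coxeter group of type `B`, the node `0` being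
the end of the edge labelled `4`. -/
structure TypeBRelations (s : ℕ → G) (n : ℕ) : Prop where
  sq : ∀ i < n, s i * s i = 1
  four : 1 < n → s 0 * s 1 * s 0 * s 1 = s 1 * s 0 * s 1 * s 0
  braid : ∀ i, 1 ≤ i → i + 1 < n → s i * s (i + 1) * s i = s (i + 1) * s i * s (i + 1)
  comm : ∀ i j, i + 2 ≤ j → j < n → s i * s j = s j * s i

namespace TypeBRelations

variable {s : ℕ → G} {n : ℕ} (h : TypeBRelations s n)
include h

theorem mul_ascendingProd_of_lt (l i j : ℕ) (hj : j + 2 ≤ i) (hi : i + l ≤ n) :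
    s j * ascendingProd s i l = ascendingProd s i l * s j := by
  induction l generalizing i with
  | zero => simp [ascendingProd]
  | succ l ih =>
    rw [ascendingProd, ← mul_assoc, h.comm j i hj (by omega), mul_assoc,
      ih (i + 1) (by omega) (by omega), mul_assoc]

/-- A braid relation at `s (j - 1) * s j` lowers the index by one; the other factors commute. The
bound `2 ≤ j` avoids the edge labelled 4, where no braid relation holds. -/
theorem mul_ascendingProd_of_gt (l i j : ℕ) (hi : i < j) (hj : j < i + l) (hl : i + l ≤ n)
    (hj2 : 2 ≤ j) : s j * ascendingProd s i l = ascendingProd s i l * s (j - 1) := by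
  induction l generalizing i with
  | zero => omega
  | succ l ih =>
    rcases (show i + 1 ≤ j from hi).eq_or_lt with hij | hij
    · obtain ⟨l, rfl⟩ := Nat.exists_eq_succ_of_ne_zero (show l ≠ 0 by omega)
      subst hij
      have h1 := h.mul_ascendingProd_of_lt l (i + 2) i le_rfl (by omega)
      simp only [ascendingProd, Nat.add_sub_cancel]
      rw [show i + 1 + 1 = i + 2 from rfl, mul_assoc, mul_assoc, ← h1, ← mul_assoc, ← mul_assoc,
        ← h.braid i (by omega) (by omega)]
      simp only [mul_assoc]
    · rw [ascendingProd, ← mul_assoc, ← h.comm i j hij (by omega), mul_assoc,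
        ih (i + 1) hij (by omega) (by omega), mul_assoc]

theorem mul_valleyProd_of_gt (k i j : ℕ) (hij : i + 2 ≤ j) (hj : j ≤ k) (hk : k < n) :
    s j * valleyProd s k i = valleyProd s k i * s (j - 1) := by
  induction i with
  | zero => exact h.mul_ascendingProd_of_gt _ _ _ (by omega) (by omega) (by omega) (by omega)
  | succ i ih =>
    rw [valleyProd, ← mul_assoc, ← h.comm (i + 1) j (by omega) (by omega), mul_assoc,
      ih (by omega), mul_assoc]

/-- Passing the descending half raises the index to `j + 1`, and passing the ascending half lowers
it again. For `j = 0` the relation of length four does both at once. -/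
theorem mul_valleyProd_of_lt (k i j : ℕ) (hj : j < i) (hi : i ≤ k) (hk : k < n) :
    s j * valleyProd s k i = valleyProd s k i * s j := by
  induction i with
  | zero => omega
  | succ i ih =>
    rcases (show j ≤ i by omega).eq_or_lt with hij | hij
    · subst hij
      rcases Nat.eq_zero_or_pos j with rfl | hj0
      · obtain ⟨k, rfl⟩ := Nat.exists_eq_succ_of_ne_zero (show k ≠ 0 by omega)
        have h1 := h.mul_ascendingProd_of_lt k 2 0 le_rfl (by omega)
        simp only [valleyProd, ascendingProd, Nat.zero_add, one_add_one_eq_two]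
        have h4 := h.four (by omega)
        simp only [mul_assoc] at h4 ⊢
        rw [← h1]
        simp only [← mul_assoc] at h4 ⊢
        rw [h4]
      · obtain ⟨j, rfl⟩ := Nat.exists_eq_succ_of_ne_zero hj0.ne'
        have h1 := h.mul_valleyProd_of_gt k j (j + 2) le_rfl (by omega) hk
        have h2 := h.braid (j + 1) (by omega) (by omega)
        simp only [valleyProd, Nat.succ_eq_add_one]
        simp only [show j + 2 - 1 = j + 1 by omega] at h1
        rw [mul_assoc, mul_assoc, ← h1]
        simp only [← mul_assoc]
        rw [h2]
    · rw [valleyProd, ← mul_assoc, h.comm j (i + 1) (by omega) (by omega), mul_assoc,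
        ih hij (by omega), mul_assoc]

/-- The ascending products ending in `s k` (the empty one included) and the valley products
represent the left cosets of the group of the first `k` reflections: left multiplication by a
generator sends each to another one, or to itself, up to a right factor in that group. -/
theorem exists_eq_mul_of_mem_closure {k : ℕ} (hk : k < n) {g : G}
    (hg : g ∈ Subgroup.closure (s '' Set.Iio (k + 1))) :
    ∃ c, ∃ x ∈ Subgroup.closure (s '' Set.Iio k), g = c * x ∧
      ((∃ i l, 1 ≤ i ∧ i + l = k + 1 ∧ c = ascendingProd s i l) ∨
        ∃ i ≤ k, c = valleyProd s k i) := by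
  have hs : ∀ i, i < k → s i ∈ Subgroup.closure (s '' Set.Iio k) :=
    fun i hi => Subgroup.subset_closure ⟨i, hi, rfl⟩
  have hstep : ∀ j ≤ k, ∀ g, (∃ c, ∃ x ∈ Subgroup.closure (s '' Set.Iio k), g = c * x ∧
      ((∃ i l, 1 ≤ i ∧ i + l = k + 1 ∧ c = ascendingProd s i l) ∨
        ∃ i ≤ k, c = valleyProd s k i)) →
      ∃ c, ∃ x ∈ Subgroup.closure (s '' Set.Iio k), s j * g = c * x ∧
      ((∃ i l, 1 ≤ i ∧ i + l = k + 1 ∧ c = ascendingProd s i l) ∨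
        ∃ i ≤ k, c = valleyProd s k i) := by
    rintro j hj _ ⟨c, x, hx, rfl, ⟨i, l, hi, hl, rfl⟩ | ⟨i, hi, rfl⟩⟩
    · rcases lt_trichotomy (j + 1) i with hji | rfl | hji
      · refine ⟨_, s j * x, mul_mem (hs j (by omega)) hx, ?_, Or.inl ⟨i, l, hi, hl, rfl⟩⟩
        rw [← mul_assoc, h.mul_ascendingProd_of_lt l i j hji (by omega), mul_assoc]
      · refine ⟨ascendingProd s j (l + 1), x, hx, ?_, ?_⟩
        · rw [ascendingProd, ← mul_assoc]
        · rcases Nat.eq_zero_or_pos j with rfl | hj0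
          · refine Or.inr ⟨0, by omega, ?_⟩
            rw [valleyProd, show k = l by omega]
          · exact Or.inl ⟨j, l + 1, hj0, by omega, rfl⟩
      · rcases (show i ≤ j by omega).eq_or_lt with rfl | hij
        · obtain ⟨l, rfl⟩ := Nat.exists_eq_succ_of_ne_zero (show l ≠ 0 by omega)
          refine ⟨ascendingProd s (i + 1) l, x, hx, ?_, Or.inl ⟨i + 1, l, by omega, by omega, rfl⟩⟩
          rw [ascendingProd, ← mul_assoc, ← mul_assoc, h.sq i (by omega), one_mul]
        · refine ⟨_, s (j - 1) * x, mul_mem (hs _ (by omega)) hx, ?_, Or.inl ⟨i, l, hi, hl, rfl⟩⟩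
          rw [← mul_assoc, h.mul_ascendingProd_of_gt l i j hij (by omega) (by omega) (by omega),
            mul_assoc]
    · rcases lt_trichotomy j i with hji | rfl | hji
      · refine ⟨_, s j * x, mul_mem (hs j (by omega)) hx, ?_, Or.inr ⟨i, hi, rfl⟩⟩
        rw [← mul_assoc, h.mul_valleyProd_of_lt k i j hji hi hk, mul_assoc]
      · rcases j with _ | j
        · refine ⟨ascendingProd s 1 k, x, hx, ?_, Or.inl ⟨1, k, le_rfl, by omega, rfl⟩⟩
          rw [valleyProd, ascendingProd, ← mul_assoc, ← mul_assoc, h.sq 0 (by omega), one_mul]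
        · refine ⟨valleyProd s k j, x, hx, ?_, Or.inr ⟨j, by omega, rfl⟩⟩
          rw [valleyProd, ← mul_assoc, ← mul_assoc, h.sq _ (by omega), one_mul]
      · rcases (show i + 1 ≤ j by omega).eq_or_lt with rfl | hij
        · refine ⟨valleyProd s k (i + 1), x, hx, ?_, Or.inr ⟨i + 1, hj, rfl⟩⟩
          rw [valleyProd, mul_assoc]
        · refine ⟨_, s (j - 1) * x, mul_mem (hs _ (by omega)) hx, ?_, Or.inr ⟨i, hi, rfl⟩⟩
          rw [← mul_assoc, h.mul_valleyProd_of_gt k i j hij hj hk, mul_assoc]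
  induction hg using Subgroup.closure_induction_left with
  | one => exact ⟨1, 1, one_mem _, by simp, Or.inl ⟨k + 1, 0, by omega, rfl, rfl⟩⟩
  | mul_left x hx y _ ih =>
    obtain ⟨j, hj, rfl⟩ := hx
    exact hstep j (Nat.lt_succ_iff.1 hj) y ih
  | inv_mul_cancel x hx y _ ih =>
    obtain ⟨j, hj, rfl⟩ := hx
    have hj' : j ≤ k := Nat.lt_succ_iff.1 hj
    rw [inv_eq_of_mul_eq_one_right (h.sq j (by omega))]
    exact hstep j hj' y ih

end TypeBRelations

@[simp]
theorem dswap_apply_inl {n : ℕ} (a b i : Fin n) :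
    dswap a b (Sum.inl i) = Sum.inl (Equiv.swap a b i) := by
  rw [dswap, Equiv.Perm.mul_apply,
    Equiv.swap_apply_of_ne_of_ne (a := Sum.inr a) (b := Sum.inr b) (by simp) (by simp)]
  exact (Sum.inl_injective.map_swap a b i).symm

@[simp]
theorem dswap_apply_inr {n : ℕ} (a b i : Fin n) :
    dswap a b (Sum.inr i) = Sum.inr (Equiv.swap a b i) := by
  rw [dswap, Equiv.Perm.mul_apply, ← Sum.inr_injective.map_swap a b i]
  exact Equiv.swap_apply_of_ne_of_ne (by simp) (by simp)

theorem betaPerm_apply_inl_of_lt {n : ℕ} {i : Fin n} {j : ℕ} (hj : j < i) :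
    betaPerm (⟨j, hj.trans i.2⟩ : Fin n) (Sum.inl i) = Sum.inl i := by
  unfold betaPerm
  split_ifs with h0
  · exact Equiv.swap_apply_of_ne_of_ne (by simp [Fin.ext_iff]; omega) (by simp)
  · rw [dswap_apply_inl, Equiv.swap_apply_of_ne_of_ne]
    all_goals simp only [pt, ne_eq, Fin.ext_iff]; omega

theorem betaPerm_apply_inl_self {n : ℕ} {j : ℕ} (hj : j + 1 < n) :
    betaPerm (⟨j + 1, hj⟩ : Fin n) (Sum.inl ⟨j + 1, hj⟩) = Sum.inl ⟨j, by omega⟩ := by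
  simp [betaPerm, pt]

theorem betaPerm_apply_inr {n : ℕ} {j : ℕ} (hj : j + 1 < n) :
    betaPerm (⟨j + 1, hj⟩ : Fin n) (Sum.inr ⟨j, by omega⟩) = Sum.inr ⟨j + 1, hj⟩ := by
  simp [betaPerm, pt]

theorem betaPerm_zero_apply {n : ℕ} (h : 0 < n) :
    betaPerm (⟨0, h⟩ : Fin n) (Sum.inl ⟨0, h⟩) = Sum.inr ⟨0, h⟩ := by
  simp [betaPerm]

/-- The first `k` reflections fix `Sum.inl k`, whereas every coset representative except the empty
product moves it. So an element of the kernel lies in the smaller group, and induction applies. -/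
theorem TypeBRelations.eq_one_of_map_eq_one {s : ℕ → G} {n : ℕ} (h : TypeBRelations s n)
    (ρ : G →* Equiv.Perm (Fin n ⊕ Fin n)) (hρ : ∀ j (hj : j < n), ρ (s j) = betaPerm ⟨j, hj⟩)
    {k : ℕ} (hk : k ≤ n) {g : G} (hg : g ∈ Subgroup.closure (s '' Set.Iio k)) (h1 : ρ g = 1) :
    g = 1 := by
  induction k generalizing g with
  | zero => simpa using hg
  | succ k ih =>
    have hkn : k < n := hk
    have hasc : ∀ l i (hi : i + l = k), ρ (ascendingProd s (i + 1) l) (Sum.inl ⟨k, hkn⟩) =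
        Sum.inl ⟨i, by omega⟩ := by
      intro l
      induction l with
      | zero => intro i hi; simp [ascendingProd, show k = i by omega]
      | succ l ihl =>
        intro i hi
        rw [ascendingProd, map_mul, Equiv.Perm.mul_apply, ihl (i + 1) (by omega),
          hρ _ (by omega), betaPerm_apply_inl_self (by omega)]
    have hval : ∀ i (hi : i ≤ k), ρ (valleyProd s k i) (Sum.inl ⟨k, hkn⟩) =
        Sum.inr ⟨i, by omega⟩ := by
      intro i
      induction i with
      | zero =>
        intro _
        rw [valleyProd, ascendingProd, map_mul, Equiv.Perm.mul_apply, hasc k 0 (by omega),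
          hρ 0 (by omega), betaPerm_zero_apply]
      | succ i ihi =>
        intro hi
        rw [valleyProd, map_mul, Equiv.Perm.mul_apply, ihi (by omega), hρ _ (by omega),
          betaPerm_apply_inr]
    obtain ⟨c, x, hx, rfl, hc⟩ := h.exists_eq_mul_of_mem_closure hkn hg
    have hfix : ρ x (Sum.inl ⟨k, hkn⟩) = Sum.inl ⟨k, hkn⟩ := by
      have : Subgroup.closure (s '' Set.Iio k) ≤
          (MulAction.stabilizer (Equiv.Perm (Fin n ⊕ Fin n))
            (Sum.inl ⟨k, hkn⟩ : Fin n ⊕ Fin n)).comap ρ := by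
        rw [Subgroup.closure_le]
        rintro _ ⟨j, hj, rfl⟩
        rw [Set.mem_Iio] at hj
        simp only [SetLike.mem_coe, Subgroup.mem_comap, MulAction.mem_stabilizer_iff,
          Equiv.Perm.smul_def]
        rw [hρ j (by omega)]
        exact betaPerm_apply_inl_of_lt (i := ⟨k, hkn⟩) hj
      exact this hx
    have hcfix : ρ c (Sum.inl ⟨k, hkn⟩) = Sum.inl ⟨k, hkn⟩ := by
      have := congrArg (fun p : Equiv.Perm (Fin n ⊕ Fin n) => p (Sum.inl ⟨k, hkn⟩)) h1
      simpa [hfix] using this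
    obtain ⟨i, l, hi, hl, rfl⟩ | ⟨i, hi, rfl⟩ := hc
    · obtain ⟨i, rfl⟩ := Nat.exists_eq_succ_of_ne_zero (show i ≠ 0 by omega)
      rw [Nat.succ_eq_add_one, hasc l i (by omega)] at hcfix
      simp only [Sum.inl.injEq, Fin.mk.injEq] at hcfix
      obtain rfl : l = 0 := by omega
      simp only [ascendingProd, one_mul] at h1 ⊢
      exact ih (by omega) hx h1
    · rw [hval i hi] at hcfix
      simp at hcfix

end TypeB

/-! ### Signed permutations -/

section SignedPermutations

variable {n : ℕ}

/-- The embedding of the permutations of `{1, …, n}` as the signed permutations without signs. -/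
def liftHom (n : ℕ) : Equiv.Perm (Fin n) →* Equiv.Perm (Fin n ⊕ Fin n) :=
  (Equiv.Perm.sumCongrHom _ _).comp ((MonoidHom.id _).prod (MonoidHom.id _))

@[simp]
theorem liftHom_apply_inl (σ : Equiv.Perm (Fin n)) (i : Fin n) :
    liftHom n σ (Sum.inl i) = Sum.inl (σ i) := rfl

@[simp]
theorem liftHom_apply_inr (σ : Equiv.Perm (Fin n)) (i : Fin n) :
    liftHom n σ (Sum.inr i) = Sum.inr (σ i) := rfl

theorem dswap_eq_liftHom (a b : Fin n) : dswap a b = liftHom n (Equiv.swap a b) := by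
  ext x
  rcases x with x | x <;> simp

@[simp]
theorem dswap_mul_self (a b : Fin n) : dswap a b * dswap a b = 1 := by
  rw [dswap_eq_liftHom, ← map_mul, Equiv.swap_mul_self, map_one]

theorem dswap_inv (a b : Fin n) : (dswap a b)⁻¹ = dswap a b :=
  inv_eq_of_mul_eq_one_right (dswap_mul_self a b)

theorem dswap_comm (a b : Fin n) : dswap a b = dswap b a := by
  rw [dswap_eq_liftHom, dswap_eq_liftHom, Equiv.swap_comm]


/-- The group of signed permutations, as the centralizer of `-1`. -/
def signedPerms (n : ℕ) : Subgroup (Equiv.Perm (Fin n ⊕ Fin n)) :=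
  Subgroup.centralizer {Equiv.sumComm (Fin n) (Fin n)}

theorem mem_signedPerms_iff {g : Equiv.Perm (Fin n ⊕ Fin n)} :
    g ∈ signedPerms n ↔ ∀ x, g x.swap = (g x).swap := by
  rw [signedPerms, Subgroup.mem_centralizer_singleton_iff, Equiv.ext_iff]
  rfl

theorem apply_inr_of_mem_signedPerms {g : Equiv.Perm (Fin n ⊕ Fin n)} (hg : g ∈ signedPerms n)
    (i : Fin n) : g (Sum.inr i) = (g (Sum.inl i)).swap :=
  mem_signedPerms_iff.1 hg (Sum.inl i)

theorem liftHom_mem_signedPerms (σ : Equiv.Perm (Fin n)) : liftHom n σ ∈ signedPerms n := by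
  rw [mem_signedPerms_iff]
  rintro (x | x) <;> rfl

theorem dswap_mem_signedPerms (a b : Fin n) : dswap a b ∈ signedPerms n := by
  rw [dswap_eq_liftHom]
  exact liftHom_mem_signedPerms _

/-- The sign change of the coordinate `i`. -/
def negOne (i : Fin n) : Equiv.Perm (Fin n ⊕ Fin n) :=
  Equiv.swap (Sum.inl i) (Sum.inr i)

theorem negOne_mul_self (i : Fin n) : negOne i * negOne i = 1 := Equiv.swap_mul_self _ _

theorem negOne_inv (i : Fin n) : (negOne i)⁻¹ = negOne i := Equiv.swap_inv _ _

/-- The sign change of the coordinates in `S`. -/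
def negSet (S : Finset (Fin n)) : Equiv.Perm (Fin n ⊕ Fin n) where
  toFun x := if Sum.elim id id x ∈ S then x.swap else x
  invFun x := if Sum.elim id id x ∈ S then x.swap else x
  left_inv x := by rcases x with x | x <;> by_cases h : x ∈ S <;> simp [h]
  right_inv x := by rcases x with x | x <;> by_cases h : x ∈ S <;> simp [h]

theorem negSet_apply (S : Finset (Fin n)) (x : Fin n ⊕ Fin n) :
    negSet S x = if Sum.elim id id x ∈ S then x.swap else x := rfl

theorem negOne_eq_negSet (i : Fin n) : negOne i = negSet {i} := by
  ext1 x
  rcases x with x | x <;> by_cases h : x = i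
  · simp [negSet_apply, negOne, h]
  · rw [negOne, Equiv.swap_apply_of_ne_of_ne (by simpa using h) (by simp)]
    simp [negSet_apply, h]
  · simp [negSet_apply, negOne, h]
  · rw [negOne, Equiv.swap_apply_of_ne_of_ne (by simp) (by simpa using h)]
    simp [negSet_apply, h]

theorem negSet_empty : negSet (∅ : Finset (Fin n)) = 1 := by
  ext1 x
  simp [negSet_apply]

theorem negSet_commute (S T : Finset (Fin n)) : Commute (negSet S) (negSet T) := by
  ext1 x
  rcases x with x | x <;> by_cases h : x ∈ S <;> by_cases h' : x ∈ T <;> simp [negSet_apply, h, h']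

theorem negSet_insert {a : Fin n} {S : Finset (Fin n)} (ha : a ∉ S) :
    negSet (insert a S) = negOne a * negSet S := by
  rw [negOne_eq_negSet]
  ext1 x
  rcases x with x | x <;> by_cases h : x = a <;> by_cases h' : x ∈ S <;>
    simp_all [negSet_apply]

theorem negSet_mem_signedPerms (S : Finset (Fin n)) : negSet S ∈ signedPerms n := by
  rw [mem_signedPerms_iff]
  rintro (x | x) <;> by_cases h : x ∈ S <;> simp [negSet_apply, h]

theorem negOne_mem_signedPerms (i : Fin n) : negOne i ∈ signedPerms n := by
  rw [negOne_eq_negSet]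
  exact negSet_mem_signedPerms _

theorem negSet_mem {H : Subgroup (Equiv.Perm (Fin n ⊕ Fin n))} {S : Finset (Fin n)}
    (hS : ∀ i ∈ S, negOne i ∈ H) : negSet S ∈ H := by
  induction S using Finset.induction_on with
  | empty => simp [negSet_empty]
  | insert a S ha ih =>
    rw [negSet_insert ha]
    exact mul_mem (hS a (by simp)) (ih fun i hi => hS i (by simp [hi]))

theorem negFrom_eq_negSet (k : ℕ) :
    negFrom n k = negSet (Finset.univ.filter fun i : Fin n => k ≤ (i : ℕ) + 1) := by
  ext1 x
  simp [negFrom, negSet_apply]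

theorem negSet_univ : negSet (Finset.univ : Finset (Fin n)) = Equiv.sumComm _ _ := by
  ext1 x
  simp [negSet_apply]

theorem negFrom_one : negFrom n 1 = Equiv.sumComm _ _ := by
  rw [negFrom_eq_negSet, ← negSet_univ]
  congr
  simp

theorem negFrom_mem_signedPerms (k : ℕ) : negFrom n k ∈ signedPerms n := by
  rw [negFrom_eq_negSet]
  exact negSet_mem_signedPerms _

theorem negFrom_apply_inl (k : ℕ) (i : Fin n) :
    negFrom n k (Sum.inl i) = if k ≤ (i : ℕ) + 1 then Sum.inr i else Sum.inl i := rfl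

theorem negFrom_apply_inr (k : ℕ) (i : Fin n) :
    negFrom n k (Sum.inr i) = if k ≤ (i : ℕ) + 1 then Sum.inl i else Sum.inr i := rfl

theorem conj_negOne {g : Equiv.Perm (Fin n ⊕ Fin n)} (hg : g ∈ signedPerms n) {i j : Fin n}
    (h : g (Sum.inl i) = Sum.inl j ∨ g (Sum.inl i) = Sum.inr j) :
    g * negOne i * g⁻¹ = negOne j := by
  rw [negOne, ← Equiv.swap_apply_apply, apply_inr_of_mem_signedPerms hg]
  rcases h with h | h
  · rw [h]; rfl
  · rw [h, Equiv.swap_comm]; rfl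

theorem conj_dswap {g : Equiv.Perm (Fin n ⊕ Fin n)} (hg : g ∈ signedPerms n) {a b a' b' : Fin n}
    (ha : g (Sum.inl a) = Sum.inl a') (hb : g (Sum.inl b) = Sum.inl b') :
    g * dswap a b * g⁻¹ = dswap a' b' := by
  have : g * dswap a b * g⁻¹ = (g * Equiv.swap (Sum.inl a) (Sum.inl b) * g⁻¹) *
      (g * Equiv.swap (Sum.inr a) (Sum.inr b) * g⁻¹) := by
    rw [dswap]; group
  rw [this, ← Equiv.swap_apply_apply, ← Equiv.swap_apply_apply, apply_inr_of_mem_signedPerms hg,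
    apply_inr_of_mem_signedPerms hg, ha, hb]
  rfl

theorem conj_dswap_of_neg {g : Equiv.Perm (Fin n ⊕ Fin n)} (hg : g ∈ signedPerms n)
    {a b a' b' : Fin n} (ha : g (Sum.inl a) = Sum.inr a') (hb : g (Sum.inl b) = Sum.inr b') :
    g * dswap a b * g⁻¹ = dswap a' b' := by
  have : g * dswap a b * g⁻¹ = (g * Equiv.swap (Sum.inl a) (Sum.inl b) * g⁻¹) *
      (g * Equiv.swap (Sum.inr a) (Sum.inr b) * g⁻¹) := by
    rw [dswap]; group
  rw [this, ← Equiv.swap_apply_apply, ← Equiv.swap_apply_apply, apply_inr_of_mem_signedPerms hg,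
    apply_inr_of_mem_signedPerms hg, ha, hb, ← dswap_inv, dswap, mul_inv_rev, Equiv.swap_inv,
    Equiv.swap_inv]
  rfl

theorem conj_liftHom_dswap (σ : Equiv.Perm (Fin n)) (a b : Fin n) :
    liftHom n σ * dswap a b * (liftHom n σ)⁻¹ = dswap (σ a) (σ b) :=
  conj_dswap (liftHom_mem_signedPerms σ) rfl rfl

theorem commute_of_conj {G : Type*} [Group G] {g h : G} (H : g * h * g⁻¹ = h) : Commute g h :=
  mul_inv_eq_iff_eq_mul.1 H

theorem dswap_commute {a b c d : Fin n} (hac : a ≠ c) (had : a ≠ d) (hbc : b ≠ c) (hbd : b ≠ d) :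
    Commute (dswap a b) (dswap c d) := by
  apply commute_of_conj
  apply conj_dswap (dswap_mem_signedPerms _ _)
  · rw [dswap_apply_inl, Equiv.swap_apply_of_ne_of_ne hac.symm hbc.symm]
  · rw [dswap_apply_inl, Equiv.swap_apply_of_ne_of_ne had.symm hbd.symm]

theorem dswap_conj_dswap {a b c : Fin n} (hac : a ≠ c) (hbc : b ≠ c) :
    dswap a b * dswap b c * dswap a b = dswap a c := by
  have := conj_liftHom_dswap (Equiv.swap a b) b c
  rw [← dswap_eq_liftHom, dswap_inv, Equiv.swap_apply_right] at this
  rw [this, Equiv.swap_apply_of_ne_of_ne hac.symm hbc.symm]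

/-- A subgroup containing the adjacent transpositions of `{p, …, q}` contains all permutations
supported there. -/
theorem mem_of_swap_mem {H : Subgroup (Equiv.Perm (Fin n))} {p q : ℕ}
    (hH : ∀ i (hi : i + 1 < n), p ≤ i → i < q →
      Equiv.swap (⟨i, by omega⟩ : Fin n) ⟨i + 1, hi⟩ ∈ H)
    {σ : Equiv.Perm (Fin n)} (hσ : ∀ i : Fin n, (i : ℕ) < p ∨ q < i → σ i = i) : σ ∈ H := by
  have hlt : ∀ d i (hi : i + d < n), p ≤ i → i + d ≤ q →
      Equiv.swap (⟨i, by omega⟩ : Fin n) ⟨i + d, hi⟩ ∈ H := by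
    intro d
    induction d with
    | zero =>
      intro i hi _ _
      rw [show (⟨i + 0, hi⟩ : Fin n) = ⟨i, by omega⟩ from rfl, Equiv.swap_self]
      exact H.one_mem
    | succ d ih =>
      intro i hi hp hq
      exact SubmonoidClass.swap_mem_trans H (ih i (by omega) hp (by omega))
        (hH (i + d) hi (by omega) (by omega))
  have hsw : ∀ a b : Fin n, p ≤ a → (a : ℕ) ≤ q → p ≤ b → (b : ℕ) ≤ q → Equiv.swap a b ∈ H := by
    have main : ∀ a b : Fin n, p ≤ a → (b : ℕ) ≤ q → a ≤ b → Equiv.swap a b ∈ H := by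
      intro a b ha hb hab
      obtain ⟨d, hd⟩ := Nat.exists_eq_add_of_le (Fin.le_def.1 hab)
      have := hlt d a (by omega) ha (by omega)
      convert this using 2
      exact Fin.ext hd
    intro a b ha ha' hb hb'
    rcases le_total a b with h | h
    · exact main a b ha hb' h
    · rw [Equiv.swap_comm]
      exact main b a hb ha' h
  let S : Set (Equiv.Perm (Fin n)) := {τ | τ.IsSwap ∧ τ ∈ H}
  suffices σ ∈ Subgroup.closure S from
    (Subgroup.closure_le H).2 (fun τ hτ => hτ.2) this
  -- A permutation lies in the group generated by a set of swaps as soon as it moves finitely many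
  -- points and preserves the orbits; here one swap from `S` joins each moved point to its image.
  rw [mem_closure_isSwap (fun τ hτ => hτ.1)]
  refine ⟨Set.toFinite _, fun x => ?_⟩
  by_cases hx : σ x = x
  · rw [hx]
    exact MulAction.mem_orbit_self x
  · have h1 : p ≤ (x : ℕ) ∧ (x : ℕ) ≤ q := by
      have := mt (hσ x) hx
      omega
    have h2 : p ≤ (σ x : ℕ) ∧ (σ x : ℕ) ≤ q := by
      have := mt (hσ (σ x)) (fun h => hx (σ.injective h))
      omega
    exact ⟨⟨Equiv.swap x (σ x), Subgroup.subset_closure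
      ⟨⟨x, σ x, fun h => hx h.symm, rfl⟩, hsw _ _ h1.1 h1.2 h2.1 h2.2⟩⟩, Equiv.swap_apply_left _ _⟩

theorem betaPerm_of_pos {j : ℕ} (hj : j + 1 < n) :
    betaPerm (⟨j + 1, hj⟩ : Fin n) = dswap ⟨j, by omega⟩ ⟨j + 1, hj⟩ := by
  simp [betaPerm, pt]

theorem betaPerm_of_zero (h : 0 < n) : betaPerm (⟨0, h⟩ : Fin n) = negOne ⟨0, h⟩ := by
  simp [betaPerm, negOne]

/-- A signed permutation is a sign change times an unsigned permutation, and the sign changes of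
single coordinates are conjugate under unsigned permutations. -/
theorem signedPerm_mem_of_negOne_mem {H : Subgroup (Equiv.Perm (Fin n ⊕ Fin n))}
    (hL : ∀ σ, liftHom n σ ∈ H) {i : Fin n} (hi : negOne i ∈ H) {g : Equiv.Perm (Fin n ⊕ Fin n)}
    (hg : g ∈ signedPerms n) : g ∈ H := by
  have hneg : ∀ j, negOne j ∈ H := fun j => by
    rw [← conj_negOne (liftHom_mem_signedPerms (Equiv.swap i j)) (i := i) (j := j) (by simp)]
    exact mul_mem (mul_mem (hL _) hi) (inv_mem (hL _))
  let f : Fin n → Fin n := fun j => Sum.elim id id (g (Sum.inl j))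
  have hgf : ∀ j, g (Sum.inl j) = Sum.inl (f j) ∨ g (Sum.inl j) = Sum.inr (f j) := fun j => by
    rcases h : g (Sum.inl j) with k | k <;> simp [f, h]
  have hf : Function.Injective f := by
    intro j k hjk
    have h1 := hgf j
    have h2 := hgf k
    rw [hjk] at h1
    have h3 := apply_inr_of_mem_signedPerms hg k
    rcases h1 with h1 | h1 <;> rcases h2 with h2 | h2
    · simpa using g.injective (h1.trans h2.symm)
    · rw [h2] at h3
      simpa using g.injective (h1.trans h3.symm)
    · rw [h2] at h3
      simpa using g.injective (h1.trans h3.symm)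
    · simpa using g.injective (h1.trans h2.symm)
  let σ : Equiv.Perm (Fin n) := Equiv.ofBijective f (Finite.injective_iff_bijective.1 hf)
  have hgσ : g = negSet (Finset.univ.filter fun k => g (Sum.inl (σ.symm k)) = Sum.inr k) *
      liftHom n σ := by
    have key : ∀ j, g (Sum.inl j) = (negSet (Finset.univ.filter
        fun k => g (Sum.inl (σ.symm k)) = Sum.inr k) * liftHom n σ) (Sum.inl j) := by
      intro j
      have hσj : σ j = f j := rfl
      rw [Equiv.Perm.mul_apply, liftHom_apply_inl, negSet_apply]
      rcases hgf j with h | h <;> simp [h, hσj] <;> simp [← hσj, h]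
    ext1 x
    rcases x with j | j
    · exact key j
    · rw [apply_inr_of_mem_signedPerms hg, key, apply_inr_of_mem_signedPerms]
      exact mul_mem (negSet_mem_signedPerms _) (liftHom_mem_signedPerms _)
  rw [hgσ]
  exact mul_mem (negSet_mem fun j _ => hneg j) (hL σ)

/-! ### The type B relations between the β_j, and the faithful representation. -/

theorem mul_pow_three_of_braid {G : Type*} [Group G] {a b : G} (ha : a * a = 1) (hb : b * b = 1)
    (h : a * b * a = b * a * b) : (a * b) ^ 3 = 1 := by
  calc (a * b) ^ 3 = (a * b * a) * (b * a * b) := by simp only [pow_succ, pow_zero, mul_assoc,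
        one_mul]
    _ = (a * b * a) * (a * b * a) := by rw [h]
    _ = a * (b * (a * a) * b) * a := by simp only [mul_assoc]
    _ = 1 := by rw [ha, mul_one, hb, mul_one, ha]

theorem betaPerm_mul_self (j : Fin n) : betaPerm j * betaPerm j = 1 := by
  rcases j with ⟨_ | j, hj⟩
  · rw [betaPerm_of_zero, negOne_mul_self]
  · rw [betaPerm_of_pos, dswap_mul_self]

theorem betaPerm_mul_pow_three {j : ℕ} (hj : j + 2 < n) :
    (betaPerm (⟨j + 1, by omega⟩ : Fin n) * betaPerm ⟨j + 2, hj⟩) ^ 3 = 1 := by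
  apply mul_pow_three_of_braid (betaPerm_mul_self _) (betaPerm_mul_self _)
  rw [betaPerm_of_pos, betaPerm_of_pos, dswap_conj_dswap (by simp; try omega) (by simp; try omega),
    dswap_comm ⟨j + 1, _⟩, dswap_comm ⟨j, _⟩ ⟨j + 1, _⟩,
    dswap_conj_dswap (by simp; try omega) (by simp; try omega), dswap_comm]

theorem betaPerm_mul_pow_four (hj : 1 < n) :
    (betaPerm (⟨0, by omega⟩ : Fin n) * betaPerm ⟨1, hj⟩) ^ 4 = 1 := by
  rw [betaPerm_of_zero, betaPerm_of_pos]
  have h : dswap (⟨0, by omega⟩ : Fin n) ⟨0 + 1, hj⟩ * negOne ⟨0, by omega⟩ *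
      dswap (⟨0, by omega⟩ : Fin n) ⟨0 + 1, hj⟩ = negOne ⟨0 + 1, hj⟩ := by
    have := conj_negOne (dswap_mem_signedPerms (⟨0, by omega⟩ : Fin n) ⟨0 + 1, hj⟩)
      (i := ⟨0, by omega⟩) (j := ⟨0 + 1, hj⟩) (by simp)
    rwa [dswap_inv] at this
  have hc : Commute (negOne (⟨0, by omega⟩ : Fin n)) (negOne ⟨0 + 1, hj⟩) := by
    rw [negOne_eq_negSet, negOne_eq_negSet]
    exact negSet_commute _ _
  rw [show 4 = 2 * 2 from rfl, pow_mul]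
  have : (negOne (⟨0, by omega⟩ : Fin n) * dswap (⟨0, by omega⟩ : Fin n) ⟨0 + 1, hj⟩) ^ 2 =
      negOne ⟨0, by omega⟩ * negOne ⟨0 + 1, hj⟩ := by
    rw [← h, sq]
    simp only [mul_assoc]
  rw [this, hc.mul_pow, sq, sq, negOne_mul_self, negOne_mul_self, one_mul]

theorem betaPerm_commute {i j : ℕ} (hij : i + 2 ≤ j) (hj : j < n) :
    Commute (betaPerm (⟨i, by omega⟩ : Fin n)) (betaPerm ⟨j, hj⟩) := by
  obtain ⟨j, rfl⟩ := Nat.exists_eq_succ_of_ne_zero (show j ≠ 0 by omega)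
  rcases i with _ | i
  · rw [betaPerm_of_zero, betaPerm_of_pos]
    refine (commute_of_conj (conj_negOne (dswap_mem_signedPerms _ _) (Or.inl ?_))).symm
    rw [dswap_apply_inl, Equiv.swap_apply_of_ne_of_ne] <;> simp <;> omega
  · rw [betaPerm_of_pos, betaPerm_of_pos]
    apply dswap_commute <;> simp <;> omega

theorem typeB_apply (i j : Fin n) : CoxeterMatrix.B n i j =
    if i = j then 1
      else (if (i : ℕ) = n - 1 ∧ (j : ℕ) = n - 2 ∨ (j : ℕ) = n - 1 ∧ (i : ℕ) = n - 2 then 4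
        else (if (j : ℕ) + 1 = i ∨ (i : ℕ) + 1 = j then 3 else 2)) := rfl

/-- `CoxeterMatrix.B` has its edge labelled 4 at the last two nodes, while β_0 and β_1 come first;
hence the reversal. -/
theorem isLiftable_betaPerm (n : ℕ) :
    (CoxeterMatrix.B n).IsLiftable fun i : Fin n => betaPerm i.rev := by
  have hinv : ∀ (a b : Fin n) (k : ℕ), (betaPerm a * betaPerm b) ^ k = 1 →
      (betaPerm b * betaPerm a) ^ k = 1 := by
    intro a b k h
    have ha := inv_eq_of_mul_eq_one_right (betaPerm_mul_self a)
    have hb := inv_eq_of_mul_eq_one_right (betaPerm_mul_self b)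
    rw [← inv_eq_one, ← inv_pow, mul_inv_rev, ha, hb] at h
    exact h
  have hcomm : ∀ i j : Fin n, (i : ℕ) + 2 ≤ j → (betaPerm i * betaPerm j) ^ 2 = 1 := by
    rintro ⟨i, hi⟩ ⟨j, hj⟩ hij
    rw [(betaPerm_commute hij hj).mul_pow, sq, sq, betaPerm_mul_self, betaPerm_mul_self, one_mul]
  have hfour : ∀ i j : Fin n, (i : ℕ) = 0 → (j : ℕ) = 1 → (betaPerm i * betaPerm j) ^ 4 = 1 := by
    rintro ⟨i, hi⟩ ⟨j, hj⟩ rfl rfl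
    exact betaPerm_mul_pow_four hj
  have hthree : ∀ i j : Fin n, 1 ≤ (i : ℕ) → (j : ℕ) = i + 1 →
      (betaPerm i * betaPerm j) ^ 3 = 1 := by
    rintro ⟨_ | i, hi⟩ ⟨j, hj⟩ h1 rfl
    · simp at h1
    · exact betaPerm_mul_pow_three hj
  intro i i'
  have h1 := Fin.val_rev i
  have h2 := Fin.val_rev i'
  have h3 := i.2
  have h4 := i'.2
  rw [typeB_apply]
  split_ifs with c1 c2 c3
  · rw [c1, betaPerm_mul_self, pow_one]
  · rcases c2 with c2 | c2
    · exact hfour _ _ (by omega) (by omega)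
    · exact hinv _ _ _ (hfour _ _ (by omega) (by omega))
  · rcases c3 with c3 | c3
    · exact hthree _ _ (by omega) (by omega)
    · exact hinv _ _ _ (hthree _ _ (by omega) (by omega))
  · have : (i : ℕ) ≠ i' := fun h => c1 (Fin.ext h)
    rcases Nat.lt_or_gt_of_ne this with h | h
    · exact hinv _ _ _ (hcomm _ _ (by omega))
    · exact hcomm _ _ (by omega)

/-- The representation of the Coxeter group of type `B` by signed permutations. -/
noncomputable def signedRep (n : ℕ) :
    (CoxeterMatrix.B n).Group →* Equiv.Perm (Fin n ⊕ Fin n) :=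
  (CoxeterMatrix.B n).toCoxeterSystem.lift ⟨_, isLiftable_betaPerm n⟩

theorem signedRep_simple (j : Fin n) :
    signedRep n ((CoxeterMatrix.B n).simple j.rev) = betaPerm j := by
  have := (CoxeterMatrix.B n).toCoxeterSystem.lift_apply_simple (isLiftable_betaPerm n) j.rev
  rw [CoxeterMatrix.toCoxeterSystem_simple, Fin.rev_rev] at this
  exact this

theorem signedRep_injective (n : ℕ) : Function.Injective (signedRep n) := by
  let cs := (CoxeterMatrix.B n).toCoxeterSystem
  let s : ℕ → (CoxeterMatrix.B n).Group := fun j => 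
    if h : j < n then cs.simple (Fin.rev ⟨j, h⟩) else 1
  have hs : ∀ j (h : j < n), s j = cs.simple (Fin.rev ⟨j, h⟩) := fun j h => dif_pos h
  have hsq : ∀ j < n, s j * s j = 1 := fun j h => by rw [hs j h, cs.simple_mul_simple_self]
  have hpow : ∀ i j (hi : i < n) (hj : j < n),
      (s i * s j) ^ (CoxeterMatrix.B n (Fin.rev ⟨i, hi⟩) (Fin.rev ⟨j, hj⟩)) = 1 := by
    intro i j hi hj
    rw [hs i hi, hs j hj]
    exact cs.simple_mul_simple_pow _ _
  have hrel : TypeBRelations s n := by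
    refine ⟨hsq, fun h => ?_, fun i h1 h => ?_, fun i j hij hj => ?_⟩
    · have hp := hpow 0 1 (by omega) h
      rw [show CoxeterMatrix.B n (Fin.rev ⟨0, by omega⟩) (Fin.rev ⟨1, h⟩) = 4 by
        simp only [typeB_apply, Fin.ext_iff, Fin.val_rev]
        rw [if_neg (by omega)]; simp] at hp
      have h0 := hsq 0 (by omega)
      have h1 := hsq 1 h
      have : (s 0 * s 1 * s 0 * s 1) * (s 0 * s 1 * s 0 * s 1) = 1 := by
        rw [← hp]; simp only [pow_succ, pow_zero, one_mul, mul_assoc]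
      rw [eq_comm, ← mul_left_inj (s 0 * s 1 * s 0 * s 1), this]
      calc _ = s 1 * s 0 * s 1 * (s 0 * s 0) * s 1 * s 0 * s 1 := by simp only [mul_assoc]
        _ = s 1 * s 0 * (s 1 * s 1) * s 0 * s 1 := by rw [h0]; simp only [mul_assoc, mul_one]
        _ = 1 := by rw [h1, mul_one, mul_assoc (s 1), h0, mul_one, h1]
    · have hp := hpow i (i + 1) (by omega) h
      rw [show CoxeterMatrix.B n (Fin.rev ⟨i, by omega⟩) (Fin.rev ⟨i + 1, h⟩) = 3 by
        simp only [typeB_apply, Fin.ext_iff, Fin.val_rev]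
        rw [if_neg (by omega), if_neg (by omega), if_pos (by omega)]] at hp
      have h0 := hsq i (by omega)
      have h1 := hsq (i + 1) h
      have : (s i * s (i + 1) * s i) * (s (i + 1) * s i * s (i + 1)) = 1 := by
        rw [← hp]; simp only [pow_succ, pow_zero, one_mul, mul_assoc]
      rw [mul_eq_one_iff_eq_inv.1 this, mul_inv_rev, mul_inv_rev, inv_eq_of_mul_eq_one_right h0,
        inv_eq_of_mul_eq_one_right h1, mul_assoc]
    · have hp := hpow i j (by omega) hj
      rw [show CoxeterMatrix.B n (Fin.rev ⟨i, by omega⟩) (Fin.rev ⟨j, hj⟩) = 2 by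
        simp only [typeB_apply, Fin.ext_iff, Fin.val_rev]
        rw [if_neg (by omega), if_neg (by omega), if_neg (by omega)]] at hp
      rw [sq] at hp
      rw [mul_eq_one_iff_eq_inv.1 hp, mul_inv_rev, inv_eq_of_mul_eq_one_right (hsq i (by omega)),
        inv_eq_of_mul_eq_one_right (hsq j hj)]
  rw [injective_iff_map_eq_one]
  intro g hg
  refine hrel.eq_one_of_map_eq_one (signedRep n) (fun j hj => ?_) le_rfl ?_ hg
  · rw [hs j hj, ← signedRep_simple]
    rfl
  · have : Set.range cs.simple ⊆ s '' Set.Iio n := by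
      rintro _ ⟨j, rfl⟩
      refine ⟨j.rev, j.rev.2, ?_⟩
      rw [hs _ j.rev.2, Fin.eta, Fin.rev_rev]
    exact Subgroup.closure_mono this (cs.subgroup_closure_range_simple ▸ Subgroup.mem_top g)

theorem signedRep_mem_signedPerms (g : (CoxeterMatrix.B n).Group) :
    signedRep n g ∈ signedPerms n := by
  induction g using (CoxeterMatrix.B n).toCoxeterSystem.simple_induction with
  | one => simp
  | mul _ _ h1 h2 => rw [map_mul]; exact mul_mem h1 h2
  | simple i =>
    have := signedRep_simple i.rev
    rw [Fin.rev_rev] at this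
    rw [CoxeterMatrix.toCoxeterSystem_simple, this]
    rcases i.rev with ⟨_ | j, hj⟩
    · rw [betaPerm_of_zero]
      exact negOne_mem_signedPerms _
    · rw [betaPerm_of_pos]
      exact dswap_mem_signedPerms _ _

theorem mem_range_signedRep (hn : 0 < n) {g : Equiv.Perm (Fin n ⊕ Fin n)}
    (hg : g ∈ signedPerms n) : ∃ w, signedRep n w = g := by
  have hβ : ∀ j, betaPerm j ∈ (signedRep n).range := fun j => ⟨_, signedRep_simple j⟩
  refine signedPerm_mem_of_negOne_mem (H := (signedRep n).range) (fun σ => ?_)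
    (i := ⟨0, hn⟩) ?_ hg
  · refine mem_of_swap_mem (H := (signedRep n).range.comap (liftHom n)) (p := 0) (q := n)
      (fun i hi _ _ => ?_) (fun i hi => by have := i.2; omega)
    rw [Subgroup.mem_comap, ← dswap_eq_liftHom, ← betaPerm_of_pos]
    exact hβ _
  · rw [← betaPerm_of_zero]
    exact hβ _

end SignedPermutations

/-! ### Signed permutations acting on a block, with a sign on the remaining coordinates -/

section Block

variable {k n : ℕ}

/-- The splitting of `{±1, …, ±n}` into `{±1, …, ±k}` and the rest. -/
def blockEquiv (h : k ≤ n) :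
    (Fin k ⊕ Fin k) ⊕ (Fin (n - k) ⊕ Fin (n - k)) ≃ Fin n ⊕ Fin n :=
  let f : Fin k ⊕ Fin (n - k) ≃ Fin n := finSumFinEquiv.trans (finCongr (by omega))
  (Equiv.sumSumSumComm _ _ _ _).trans (Equiv.sumCongr f f)

/-- The group `{1, -1}` acting by a global sign. -/
def globalSign (r : ℕ) : ℤˣ →* Equiv.Perm (Fin r ⊕ Fin r) where
  toFun ε := if ε = 1 then 1 else Equiv.sumComm _ _
  map_one' := by simp
  map_mul' a b := by
    rcases Int.units_eq_one_or a with rfl | rfl <;> rcases Int.units_eq_one_or b with rfl | rfl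
    · simp
    · simp
    · simp
    · ext x
      simp

/-- The permutation acting on `{±1, …, ±k}` as the first component, and as the sign given by the
second component on the other coordinates. -/
def blockHom (h : k ≤ n) :
    Equiv.Perm (Fin k ⊕ Fin k) × ℤˣ →* Equiv.Perm (Fin n ⊕ Fin n) :=
  (blockEquiv h).permCongrHom.toMonoidHom.comp
    ((Equiv.Perm.sumCongrHom _ _).comp ((MonoidHom.id _).prodMap (globalSign _)))

theorem blockHom_apply_inl (h : k ≤ n) (p : Equiv.Perm (Fin k ⊕ Fin k)) (ε : ℤˣ)
    (x : Fin k ⊕ Fin k) :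
    blockHom h (p, ε) (x.map (Fin.castLE h) (Fin.castLE h)) =
      (p x).map (Fin.castLE h) (Fin.castLE h) := by
  have key : ∀ y : Fin k ⊕ Fin k, blockEquiv h (Sum.inl y) =
      y.map (Fin.castLE h) (Fin.castLE h) := by
    rintro (y | y) <;> rfl
  rw [← key, ← key]
  simp [blockHom]

theorem blockHom_apply_inr (h : k ≤ n) (p : Equiv.Perm (Fin k ⊕ Fin k)) (ε : ℤˣ)
    (x : Fin n ⊕ Fin n) (hx : k ≤ (Sum.elim id id x : Fin n)) :
    blockHom h (p, ε) x = if ε = 1 then x else x.swap := by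
  obtain ⟨y, rfl⟩ : ∃ y, blockEquiv h (Sum.inr y) = x := by
    rcases x with x | x
    · refine ⟨Sum.inl ⟨x - k, by have := x.2; simp at hx; omega⟩, ?_⟩
      simp [blockEquiv, Fin.ext_iff] at hx ⊢
      omega
    · refine ⟨Sum.inr ⟨x - k, by have := x.2; simp at hx; omega⟩, ?_⟩
      simp [blockEquiv, Fin.ext_iff] at hx ⊢
      omega
  rcases Int.units_eq_one_or ε with rfl | rfl
  · simp [blockHom]
  · rcases y with y | y <;> simp [blockHom, globalSign, blockEquiv]

/-- The inequality is strict because the sign is only visible on a coordinate outside the block. -/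
theorem blockHom_injective (h : k < n) : Function.Injective (blockHom h.le) := by
  rintro ⟨p, ε⟩ ⟨p', ε'⟩ heq
  ext1
  · ext1 x
    have := congrArg (fun g : Equiv.Perm (Fin n ⊕ Fin n) =>
      g (x.map (Fin.castLE h.le) (Fin.castLE h.le))) heq
    simp only [blockHom_apply_inl] at this
    exact Sum.map_injective.2 ⟨Fin.castLE_injective _, Fin.castLE_injective _⟩ this
  · have := congrArg (fun g : Equiv.Perm (Fin n ⊕ Fin n) => g (Sum.inl ⟨k, h⟩)) heq
    rw [blockHom_apply_inr _ _ _ _ (by simp), blockHom_apply_inr _ _ _ _ (by simp)] at this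
    rcases Int.units_eq_one_or ε with rfl | rfl <;>
      rcases Int.units_eq_one_or ε' with rfl | rfl <;> simp_all

theorem perm_ext_block (h : k ≤ n) {g g' : Equiv.Perm (Fin n ⊕ Fin n)}
    (h1 : ∀ x : Fin k ⊕ Fin k, g (x.map (Fin.castLE h) (Fin.castLE h)) =
      g' (x.map (Fin.castLE h) (Fin.castLE h)))
    (h2 : ∀ x : Fin n ⊕ Fin n, k ≤ (Sum.elim id id x : Fin n) → g x = g' x) : g = g' := by
  ext1 x
  by_cases hx : k ≤ (Sum.elim id id x : Fin n)
  · exact h2 x hx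
  · rcases x with x | x
    · exact h1 (Sum.inl ⟨x, by simpa using hx⟩)
    · exact h1 (Sum.inr ⟨x, by simpa using hx⟩)

theorem blockHom_dswap (h : k ≤ n) (a b : Fin k) :
    blockHom h (dswap a b, 1) = dswap (Fin.castLE h a) (Fin.castLE h b) := by
  have hinj : Function.Injective (Fin.castLE h) := Fin.castLE_injective h
  refine perm_ext_block h (fun x => ?_) (fun x hx => ?_)
  · rw [blockHom_apply_inl]
    rcases x with x | x <;> simp [hinj.map_swap]
  · rw [blockHom_apply_inr _ _ _ _ hx, if_pos rfl]
    have ha : ∀ (a : Fin k) (y : Fin n), k ≤ (y : ℕ) → y ≠ Fin.castLE h a := by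
      rintro a y hy rfl
      have := a.2
      simp at hy
      omega
    rcases x with x | x <;> simp at hx <;>
      simp [Equiv.swap_apply_of_ne_of_ne (ha a x hx) (ha b x hx)]

/-- The bound on `l` makes every coordinate outside the block change sign. In this way computations
in one fixed finite group settle all `n` at once. -/
theorem blockHom_negFrom (h : k ≤ n) (l : ℕ) (hl : l ≤ k + 1) :
    blockHom h (negFrom k l, -1) = negFrom n l := by
  refine perm_ext_block h (fun x => ?_) (fun x hx => ?_)
  · rw [blockHom_apply_inl]
    rcases x with x | x <;> by_cases hx : l ≤ (x : ℕ) + 1 <;>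
      simp [negFrom_apply_inl, negFrom_apply_inr, hx]
  · rw [blockHom_apply_inr _ _ _ _ hx, if_neg (by decide)]
    rcases x with x | x <;> simp at hx <;>
      simp [negFrom_apply_inl, negFrom_apply_inr, show l ≤ (x : ℕ) + 1 by omega]

theorem blockHom_negOne (h : k ≤ n) (i : Fin k) :
    blockHom h (negOne i, 1) = negOne (Fin.castLE h i) := by
  refine perm_ext_block h (fun x => ?_) (fun x hx => ?_)
  · rw [blockHom_apply_inl, negOne_eq_negSet, negOne_eq_negSet]
    rcases x with x | x <;> by_cases hx : x = i <;> simp [negSet_apply, hx]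
  · rw [blockHom_apply_inr _ _ _ _ hx, if_pos rfl, negOne_eq_negSet]
    have : ∀ y : Fin n, k ≤ (y : ℕ) → y ≠ Fin.castLE h i := by
      rintro y hy rfl
      have := i.2
      simp at hy
      omega
    rcases x with x | x <;> simp at hx <;> simp [negSet_apply, this x hx]

/-- The restrictions of the first three generators, conjugated by the sign change of the fifth
coordinate, to the first seven coordinates, together with their signs on the other ones. -/
def blockGen : Fin 3 → Equiv.Perm (Fin 7 ⊕ Fin 7) × ℤˣ :=
  ![(dswap 1 2 * dswap 3 4 * negFrom 7 4, -1),
    (dswap 0 1 * dswap 2 3 * dswap 4 5 * negFrom 7 5, -1),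
    (dswap 1 2 * dswap 5 6, 1)]

/-! ### Determinants and dihedral subgroups in the seven-coordinate block. -/

theorem mul_globalSign_of_mem_signedPerms {p : Equiv.Perm (Fin k ⊕ Fin k)}
    (hp : p ∈ signedPerms k) (ε : ℤˣ) : p * globalSign k ε = globalSign k ε * p := by
  rcases Int.units_eq_one_or ε with rfl | rfl
  · simp
  · exact Subgroup.mem_centralizer_singleton_iff.1 hp

/-- The signed permutations of determinant `1`. -/
def detOne (k : ℕ) : Subgroup (Equiv.Perm (Fin k ⊕ Fin k)) where
  carrier := {p | p ∈ signedPerms k ∧ ∃ (σ : Equiv.Perm (Fin k)) (s : Fin k → ℤˣ),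
    (∀ j, p (Sum.inl j) = globalSign k (s j) (Sum.inl (σ j))) ∧
      Equiv.Perm.sign σ * ∏ j, s j = 1}
  one_mem' := ⟨one_mem _, 1, 1, fun j => by simp, by simp⟩
  mul_mem' := by
    rintro p q ⟨hp, σ, s, hs, h1⟩ ⟨hq, τ, t, ht, h2⟩
    refine ⟨mul_mem hp hq, σ * τ, fun j => t j * s (τ j), fun j => ?_, ?_⟩
    · have := Equiv.ext_iff.1 (mul_globalSign_of_mem_signedPerms hp (t j)) (Sum.inl (τ j))
      rw [Equiv.Perm.mul_apply, Equiv.Perm.mul_apply] at this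
      rw [Equiv.Perm.mul_apply, ht, this, hs, map_mul]
      rfl
    · rw [Finset.prod_mul_distrib, Equiv.prod_comp τ s, Equiv.Perm.sign_mul]
      calc _ = (Equiv.Perm.sign σ * ∏ j, s j) * (Equiv.Perm.sign τ * ∏ j, t j) := by
            simp only [mul_assoc, mul_comm, mul_left_comm]
        _ = 1 := by rw [h1, h2, one_mul]
  inv_mem' := by
    rintro p ⟨hp, σ, s, hs, h1⟩
    refine ⟨inv_mem hp, σ⁻¹, fun j => s (σ⁻¹ j), fun j => ?_, ?_⟩
    · have := Equiv.ext_iff.1 (mul_globalSign_of_mem_signedPerms hp (s (σ⁻¹ j))) (Sum.inl (σ⁻¹ j))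
      rw [Equiv.Perm.mul_apply, Equiv.Perm.mul_apply, hs, ← Equiv.Perm.mul_apply (globalSign k _),
        ← map_mul, Int.units_mul_self, map_one] at this
      rw [Equiv.Perm.inv_eq_iff_eq, this]
      simp
    · rw [Equiv.prod_comp σ⁻¹ s, Equiv.Perm.sign_inv, h1]

theorem dswap_notMem_detOne {a b : Fin k} (hab : a ≠ b) : dswap a b ∉ detOne k := by
  rintro ⟨-, σ, s, hs, h1⟩
  have h : ∀ j, s j = 1 ∧ σ j = Equiv.swap a b j := by
    intro j
    have := hs j
    rcases Int.units_eq_one_or (s j) with h | h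
    · rw [h, map_one, dswap_apply_inl] at this
      exact ⟨h, by simpa using this.symm⟩
    · rw [h, dswap_apply_inl] at this
      simp [globalSign] at this
  have hσ : σ = Equiv.swap a b := Equiv.ext fun j => (h j).2
  simp [hσ, fun j => (h j).1, Equiv.Perm.sign_swap hab] at h1

/-- The counts are two transpositions with four signs, three transpositions with three signs, and
two transpositions. This keeps single transpositions, which have determinant -1, out of the group
generated by the three. -/
theorem blockGen_mem_detOne (i : Fin 3) : (blockGen i).1 ∈ detOne 7 := by
  fin_cases i
  · refine ⟨mul_mem (mul_mem (dswap_mem_signedPerms _ _) (dswap_mem_signedPerms _ _))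
      (negFrom_mem_signedPerms _), Equiv.swap 1 2 * Equiv.swap 3 4, ![1, 1, 1, -1, -1, -1, -1],
      by decide +kernel, ?_⟩
    rw [Equiv.Perm.sign_mul, Equiv.Perm.sign_swap (by decide), Equiv.Perm.sign_swap (by decide)]
    decide
  · refine ⟨mul_mem (mul_mem (mul_mem (dswap_mem_signedPerms _ _) (dswap_mem_signedPerms _ _))
      (dswap_mem_signedPerms _ _)) (negFrom_mem_signedPerms _),
      Equiv.swap 0 1 * Equiv.swap 2 3 * Equiv.swap 4 5, ![1, 1, 1, 1, -1, -1, -1],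
      by decide +kernel, ?_⟩
    rw [Equiv.Perm.sign_mul, Equiv.Perm.sign_mul, Equiv.Perm.sign_swap (by decide),
      Equiv.Perm.sign_swap (by decide), Equiv.Perm.sign_swap (by decide)]
    decide
  · refine ⟨mul_mem (dswap_mem_signedPerms _ _) (dswap_mem_signedPerms _ _),
      Equiv.swap 1 2 * Equiv.swap 5 6, 1, by decide +kernel, ?_⟩
    rw [Equiv.Perm.sign_mul, Equiv.Perm.sign_swap (by decide), Equiv.Perm.sign_swap (by decide)]
    decide

theorem closure_pair_cases {G : Type*} [Group G] {a b : G} (ha : a * a = 1) (hb : b * b = 1)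
    {g : G} (hg : g ∈ Subgroup.closure {a, b}) :
    ∃ k : ℤ, g = (a * b) ^ k ∨ g = (a * b) ^ k * a := by
  have ha' := inv_eq_of_mul_eq_one_right ha
  have hb' := inv_eq_of_mul_eq_one_right hb
  have hconj : ∀ k : ℤ, a * (a * b) ^ k * a = (a * b) ^ (-k) := by
    intro k
    have := conj_zpow (i := k) (a := a) (b := a * b)
    rw [ha'] at this
    rw [← this, zpow_neg, ← inv_zpow, mul_inv_rev, ha', hb', ← mul_assoc, ha, one_mul]
  have hstep : ∀ x ∈ ({a, b} : Set G), ∀ y, (∃ k : ℤ, y = (a * b) ^ k ∨ y = (a * b) ^ k * a) →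
      ∃ k : ℤ, x * y = (a * b) ^ k ∨ x * y = (a * b) ^ k * a := by
    have hA : ∀ y, (∃ k : ℤ, y = (a * b) ^ k ∨ y = (a * b) ^ k * a) →
        ∃ k : ℤ, a * y = (a * b) ^ k ∨ a * y = (a * b) ^ k * a := by
      rintro y ⟨k, rfl | rfl⟩
      · refine ⟨-k, Or.inr ?_⟩
        rw [← hconj, mul_assoc _ a a, ha, mul_one]
      · refine ⟨-k, Or.inl ?_⟩
        rw [← hconj, mul_assoc]
    rintro x (rfl | rfl) y hy
    · exact hA y hy
    · obtain ⟨k, hk⟩ := hA y hy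
      have hx : x * y = (a * x) ^ (-1 : ℤ) * (a * y) := by
        rw [zpow_neg_one, mul_inv_rev, ha', hb']
        rw [mul_assoc, ← mul_assoc a a, ha, one_mul]
      refine ⟨-1 + k, ?_⟩
      rw [hx, zpow_add]
      rcases hk with hk | hk
      · exact Or.inl (by rw [hk])
      · exact Or.inr (by rw [hk, mul_assoc])
  induction hg using Subgroup.closure_induction_left with
  | one => exact ⟨0, Or.inl (by simp)⟩
  | mul_left x hx y _ ih => exact hstep x hx y ih
  | inv_mul_cancel x hx y _ ih =>
    have : x⁻¹ = x := by
      rcases hx with rfl | rfl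
      · exact ha'
      · exact hb'
    rw [this]
    exact hstep x hx y ih

theorem blockGen_mul_self (i : Fin 3) : blockGen i * blockGen i = 1 := by
  revert i
  decide +kernel

theorem eq_of_zpow_cases {G : Type*} [Group G] {r : G} {N : ℕ} (hN : 0 < N) (hr : r ^ N = 1)
    (k : ℤ) : ∃ l < N, r ^ k = r ^ l := by
  refine ⟨(k % N).toNat, ?_, ?_⟩
  · have := Int.emod_lt_of_pos k (show (0 : ℤ) < N by exact_mod_cast hN)
    have := Int.emod_nonneg k (show (N : ℤ) ≠ 0 by exact_mod_cast hN.ne')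
    omega
  · rw [← zpow_natCast, Int.toNat_of_nonneg (Int.emod_nonneg k (by exact_mod_cast hN.ne'))]
    exact zpow_eq_zpow_emod' k hr

/-- Both groups are dihedral with rotations of order dividing 12, so two lists of 24 words are
compared. -/
theorem blockGen_closure_inf :
    Subgroup.closure {blockGen 0, blockGen 1} ⊓ Subgroup.closure {blockGen 1, blockGen 2} ≤
      Subgroup.closure {blockGen 1} := by
  rintro g ⟨h1, h2⟩
  obtain ⟨k, hk⟩ := closure_pair_cases (blockGen_mul_self 0) (blockGen_mul_self 1) h1
  obtain ⟨k', hk'⟩ := closure_pair_cases (blockGen_mul_self 1) (blockGen_mul_self 2) h2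
  obtain ⟨l, hl, hkl⟩ := eq_of_zpow_cases (N := 12) (by norm_num)
    (show (blockGen 0 * blockGen 1) ^ 12 = 1 by decide +kernel) k
  obtain ⟨l', hl', hkl'⟩ := eq_of_zpow_cases (N := 12) (by norm_num)
    (show (blockGen 1 * blockGen 2) ^ 12 = 1 by decide +kernel) k'
  have key : ∀ (l l' : Fin 12) (i i' : Fin 2),
      (blockGen 0 * blockGen 1) ^ (l : ℕ) * blockGen 0 ^ (i : ℕ) =
        (blockGen 1 * blockGen 2) ^ (l' : ℕ) * blockGen 1 ^ (i' : ℕ) →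
      (blockGen 0 * blockGen 1) ^ (l : ℕ) * blockGen 0 ^ (i : ℕ) = 1 ∨
        (blockGen 0 * blockGen 1) ^ (l : ℕ) * blockGen 0 ^ (i : ℕ) = blockGen 1 := by
    decide +kernel
  obtain ⟨i, hi, hgi⟩ : ∃ i < 2, g = (blockGen 0 * blockGen 1) ^ l * blockGen 0 ^ i := by
    rcases hk with hk | hk
    · exact ⟨0, by norm_num, by rw [hk, hkl, pow_zero, mul_one]⟩
    · exact ⟨1, by norm_num, by rw [hk, hkl, pow_one]⟩
  obtain ⟨i', hi', hgi'⟩ : ∃ i < 2, g = (blockGen 1 * blockGen 2) ^ l' * blockGen 1 ^ i := by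
    rcases hk' with hk | hk
    · exact ⟨0, by norm_num, by rw [hk, hkl', pow_zero, mul_one]⟩
    · exact ⟨1, by norm_num, by rw [hk, hkl', pow_one]⟩
  rcases key ⟨l, hl⟩ ⟨l', hl'⟩ ⟨i, hi⟩ ⟨i', hi'⟩ (hgi.symm.trans hgi') with h | h
  · rw [hgi, h]
    exact one_mem _
  · rw [hgi, h]
    exact Subgroup.subset_closure rfl

/-- Modulo -1 this puts `dswap 1 2` into the group of the first three generators, although it is not
there before passing to the quotient. The intersection property of the quotients breaks at this
element. -/
theorem blockGen_word : (blockGen 1 * blockGen 2 * blockGen 0) ^ 4 * (blockGen 1 * blockGen 0) ^ 2 *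
    (blockGen 1 * blockGen 2 * blockGen 0) ^ 3 * blockGen 1 * blockGen 0 * blockGen 1 =
    (dswap 1 2 * negFrom 7 1, -1) := by
  decide +kernel

end Block

/-! ### The subgroups generated by consecutive generators -/

section Spans

variable {n : ℕ}

/-- The coordinate `i + 1`, for `i < 8`. -/
def coord (hn : 8 ≤ n) (i : ℕ) (hi : i < 8 := by omega) : Fin n := ⟨i, by omega⟩

/-- The generators, numbered from `0` and conjugated by the sign change of the fifth coordinate. -/
def twistedGen (hn : 8 ≤ n) (i : ℕ) : Equiv.Perm (Fin n ⊕ Fin n) :=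
  if h : i < 3 then blockHom (k := 7) (by omega) (blockGen ⟨i, h⟩)
  -- Past the last generator the value is 1, so the family is indexed by `ℕ` and distant members
  -- commute without any bound on the indices.
  else if h : i + 4 < n then dswap ⟨i + 3, by omega⟩ ⟨i + 4, h⟩ else 1

/-- The subgroup generated by the generators with numbers from `a` to `b - 1`. -/
def genSpan (hn : 8 ≤ n) (a b : ℕ) : Subgroup (Equiv.Perm (Fin n ⊕ Fin n)) :=
  Subgroup.closure (twistedGen hn '' Set.Ico a b)

variable (hn : 8 ≤ n)

/-- The permutations supported on `{p, …, q}`. -/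
def intervalPerms (n p q : ℕ) : Subgroup (Equiv.Perm (Fin n)) :=
  fixingSubgroup (Equiv.Perm (Fin n)) {i : Fin n | (i : ℕ) < p ∨ q < i}

theorem mem_intervalPerms {p q : ℕ} {σ : Equiv.Perm (Fin n)} :
    σ ∈ intervalPerms n p q ↔ ∀ i : Fin n, (i : ℕ) < p ∨ q < i → σ i = i :=
  mem_fixingSubgroup_iff _

theorem swap_mem_intervalPerms {p q : ℕ} {a b : Fin n} (ha : p ≤ a) (ha' : (a : ℕ) ≤ q)
    (hb : p ≤ b) (hb' : (b : ℕ) ≤ q) : Equiv.swap a b ∈ intervalPerms n p q := by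
  rw [mem_intervalPerms]
  intro i hi
  apply Equiv.swap_apply_of_ne_of_ne <;> rintro rfl <;> omega

theorem intervalPerms_mono {p q p' q' : ℕ} (hp : p' ≤ p) (hq : q ≤ q') :
    intervalPerms n p q ≤ intervalPerms n p' q' := by
  intro σ hσ
  rw [mem_intervalPerms] at hσ ⊢
  exact fun i hi => hσ i (by omega)

theorem mem_intervalPerms_of_apply_eq {p q : ℕ} (hq : q + 1 < n) {σ : Equiv.Perm (Fin n)}
    (hσ : σ ∈ intervalPerms n p (q + 1)) (h : σ ⟨q + 1, hq⟩ = ⟨q + 1, hq⟩) :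
    σ ∈ intervalPerms n p q := by
  rw [mem_intervalPerms] at hσ ⊢
  intro i hi
  rcases eq_or_ne (i : ℕ) (q + 1) with h' | h'
  · rwa [show i = ⟨q + 1, hq⟩ from Fin.ext h']
  · exact hσ i (by omega)

theorem twistedGen_block {i : ℕ} (h : i < 3) :
    twistedGen hn i = blockHom (k := 7) (by omega) (blockGen ⟨i, h⟩) := dif_pos h

theorem twistedGen_of_ge {i : ℕ} (h : 3 ≤ i) (hi : i + 4 < n) :
    twistedGen hn i = dswap ⟨i + 3, by omega⟩ ⟨i + 4, hi⟩ := by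
  rw [twistedGen, dif_neg (by omega), dif_pos hi]

theorem twistedGen_zero :
    twistedGen hn 0 = dswap (coord hn 1) (coord hn 2) * dswap (coord hn 3) (coord hn 4) *
      negFrom n 4 := by
  rw [twistedGen_block hn (by norm_num),
    show blockGen ⟨0, by norm_num⟩ = (dswap 1 2, 1) * (dswap 3 4, 1) * (negFrom 7 4, -1) from rfl,
    map_mul, map_mul, blockHom_dswap, blockHom_dswap, blockHom_negFrom _ _ (by norm_num)]
  rfl

/-- The element `(1, 2)(3, 4)` with a sign change of the coordinates from `5` on. -/
def pairSwap : Equiv.Perm (Fin n ⊕ Fin n) :=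
  dswap (coord hn 0) (coord hn 1) * dswap (coord hn 2) (coord hn 3) * negFrom n 5

theorem pairSwap_eq_blockHom : pairSwap hn = blockHom (k := 7) (by omega)
    (dswap 0 1 * dswap 2 3 * negFrom 7 5, -1) := by
  rw [show (dswap 0 1 * dswap 2 3 * negFrom 7 5, (-1 : ℤˣ)) =
      (dswap (0 : Fin 7) 1, (1 : ℤˣ)) * (dswap 2 3, 1) * (negFrom 7 5, -1) from rfl,
    map_mul, map_mul, blockHom_dswap, blockHom_dswap, blockHom_negFrom _ _ (by norm_num)]
  rfl

theorem dswap_coord_eq_blockHom {i j : ℕ} (hi : i < 7) (hj : j < 7) :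
    dswap (coord hn i) (coord hn j) = blockHom (k := 7) (by omega)
      (dswap ⟨i, hi⟩ ⟨j, hj⟩, 1) := by
  rw [blockHom_dswap]
  rfl

/-- This is what the conjugation is for: the signs are now the same on all coordinates from index 4
on, so `pairSwap hn` commutes with the unsigned permutations of these coordinates. -/
theorem twistedGen_one :
    twistedGen hn 1 = pairSwap hn * dswap (coord hn 4) (coord hn 5) := by
  rw [twistedGen_block hn (by norm_num), pairSwap_eq_blockHom,
    dswap_coord_eq_blockHom hn (by norm_num) (by norm_num), ← map_mul]
  congr 1
  decide +kernel

theorem twistedGen_two :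
    twistedGen hn 2 = dswap (coord hn 1) (coord hn 2) * dswap (coord hn 5) (coord hn 6) := by
  rw [twistedGen_block hn (by norm_num), dswap_coord_eq_blockHom hn (by norm_num) (by norm_num),
    dswap_coord_eq_blockHom hn (by norm_num) (by norm_num), ← map_mul]
  rfl

theorem pairSwap_apply {i : Fin n} (hi : 4 ≤ (i : ℕ)) : pairSwap hn (Sum.inl i) = Sum.inr i := by
  rw [pairSwap, Equiv.Perm.mul_apply, negFrom_apply_inl, if_pos (by omega), Equiv.Perm.mul_apply,
    dswap_apply_inr, dswap_apply_inr, Equiv.swap_apply_of_ne_of_ne (a := coord hn 2),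
    Equiv.swap_apply_of_ne_of_ne] <;> simp only [coord, ne_eq, Fin.ext_iff] <;> omega

theorem twistedGen_zero_apply {i : Fin n} (hi : 5 ≤ (i : ℕ)) :
    twistedGen hn 0 (Sum.inl i) = Sum.inr i := by
  rw [twistedGen_zero, Equiv.Perm.mul_apply, negFrom_apply_inl, if_pos (by omega),
    Equiv.Perm.mul_apply, dswap_apply_inr, dswap_apply_inr,
    Equiv.swap_apply_of_ne_of_ne (a := coord hn 3), Equiv.swap_apply_of_ne_of_ne] <;>
    simp only [coord, ne_eq, Fin.ext_iff] <;> omega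

theorem dswap_apply_of_ne {a b i : Fin n} (ha : i ≠ a) (hb : i ≠ b) :
    dswap a b (Sum.inl i) = Sum.inl i := by
  rw [dswap_apply_inl, Equiv.swap_apply_of_ne_of_ne ha hb]

theorem twistedGen_one_apply {i : Fin n} (hi : 6 ≤ (i : ℕ)) :
    twistedGen hn 1 (Sum.inl i) = Sum.inr i := by
  rw [twistedGen_one, Equiv.Perm.mul_apply, dswap_apply_of_ne, pairSwap_apply hn (by omega)] <;>
    simp only [coord, ne_eq, Fin.ext_iff] <;> omega

theorem twistedGen_apply_of_lt {i : Fin n} {j b : ℕ} (h2 : 2 ≤ j) (hjb : j < b)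
    (hi : b + 3 < i) : twistedGen hn j (Sum.inl i) = Sum.inl i := by
  have := i.2
  rcases h2.eq_or_lt with rfl | h3
  · rw [twistedGen_two, Equiv.Perm.mul_apply, dswap_apply_of_ne, dswap_apply_of_ne] <;>
      simp only [coord, ne_eq, Fin.ext_iff] <;> omega
  · rw [twistedGen_of_ge hn h3 (by omega), dswap_apply_of_ne] <;>
      simp only [ne_eq, Fin.ext_iff] <;> omega

theorem pairSwap_mem_signedPerms : pairSwap hn ∈ signedPerms n :=
  mul_mem (mul_mem (dswap_mem_signedPerms _ _) (dswap_mem_signedPerms _ _))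
    (negFrom_mem_signedPerms _)

theorem twistedGen_mem_signedPerms (i : ℕ) : twistedGen hn i ∈ signedPerms n := by
  by_cases h3 : 3 ≤ i
  · by_cases hi : i + 4 < n
    · rw [twistedGen_of_ge hn h3 hi]
      exact dswap_mem_signedPerms _ _
    · rw [twistedGen, dif_neg (by omega), dif_neg hi]
      exact one_mem _
  · interval_cases i
    · rw [twistedGen_zero]
      exact mul_mem (mul_mem (dswap_mem_signedPerms _ _) (dswap_mem_signedPerms _ _))
        (negFrom_mem_signedPerms _)
    · rw [twistedGen_one]
      exact mul_mem (pairSwap_mem_signedPerms hn) (dswap_mem_signedPerms _ _)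
    · rw [twistedGen_two]
      exact mul_mem (dswap_mem_signedPerms _ _) (dswap_mem_signedPerms _ _)

theorem twistedGen_mem_genSpan {a b i : ℕ} (ha : a ≤ i) (hb : i < b) :
    twistedGen hn i ∈ genSpan hn a b :=
  Subgroup.subset_closure ⟨i, ⟨ha, hb⟩, rfl⟩

theorem genSpan_le {a b : ℕ} {H : Subgroup (Equiv.Perm (Fin n ⊕ Fin n))}
    (h : ∀ i, a ≤ i → i < b → twistedGen hn i ∈ H) : genSpan hn a b ≤ H := by
  rw [genSpan, Subgroup.closure_le]
  rintro _ ⟨i, hi, rfl⟩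
  exact h i hi.1 hi.2

theorem genSpan_mono {a b c d : ℕ} (hca : c ≤ a) (hbd : b ≤ d) :
    genSpan hn a b ≤ genSpan hn c d :=
  genSpan_le hn fun _ h1 h2 => twistedGen_mem_genSpan hn (hca.trans h1) (h2.trans_le hbd)

theorem commute_negOne_of_apply {g : Equiv.Perm (Fin n ⊕ Fin n)} (hg : g ∈ signedPerms n)
    {i : Fin n} (h : g (Sum.inl i) = Sum.inl i ∨ g (Sum.inl i) = Sum.inr i) :
    Commute g (negOne i) :=
  commute_of_conj (conj_negOne hg h)

/-- Each generator either fixes or negates the coordinate `i`. Commuting with `negOne i` expresses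
this without fixing the sign, which the generators 0 and 1 change. -/
theorem commute_negOne_of_mem_genSpan {b : ℕ} (hb : 3 ≤ b) {i : Fin n} (hi : b + 3 < i)
    {g : Equiv.Perm (Fin n ⊕ Fin n)} (hg : g ∈ genSpan hn 0 b) : Commute g (negOne i) := by
  suffices genSpan hn 0 b ≤ Subgroup.centralizer {negOne i} from
    Subgroup.mem_centralizer_singleton_iff.1 (this hg)
  refine genSpan_le hn fun j _ hj => ?_
  rw [Subgroup.mem_centralizer_singleton_iff]
  refine commute_negOne_of_apply (twistedGen_mem_signedPerms hn j) ?_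
  by_cases h2 : 2 ≤ j
  · exact Or.inl (twistedGen_apply_of_lt hn h2 hj hi)
  · interval_cases j
    · exact Or.inr (twistedGen_zero_apply hn (by omega))
    · exact Or.inr (twistedGen_one_apply hn (by omega))

theorem apply_eq_of_commute_negOne {σ : Equiv.Perm (Fin n)} {i : Fin n}
    (h : Commute (liftHom n σ) (negOne i)) : σ i = i := by
  have h1 := conj_negOne (liftHom_mem_signedPerms σ) (i := i) (j := σ i) (by simp)
  rw [h.eq, mul_inv_cancel_right] at h1
  have h2 := congrArg (fun g : Equiv.Perm (Fin n ⊕ Fin n) => g (Sum.inl i)) h1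
  by_contra hne
  simp [negOne_eq_negSet, negSet_apply, Ne.symm hne] at h2

theorem genSpan_le_map_liftHom {a b : ℕ} (ha : 3 ≤ a) (hb : b + 4 ≤ n) :
    genSpan hn a b ≤ (intervalPerms n (a + 3) (b + 3)).map (liftHom n) := by
  refine genSpan_le hn fun i hi hib => ?_
  rw [twistedGen_of_ge hn (by omega) (by omega), dswap_eq_liftHom]
  refine Subgroup.mem_map_of_mem _ (swap_mem_intervalPerms ?_ ?_ ?_ ?_) <;> simp only <;> omega

theorem liftHom_mem_of_dswap_mem {H : Subgroup (Equiv.Perm (Fin n ⊕ Fin n))} {p q : ℕ}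
    (hH : ∀ i (hi : i + 1 < n), p ≤ i → i < q →
      dswap (⟨i, by omega⟩ : Fin n) ⟨i + 1, hi⟩ ∈ H)
    {σ : Equiv.Perm (Fin n)} (hσ : σ ∈ intervalPerms n p q) : liftHom n σ ∈ H := by
  refine mem_of_swap_mem (H := H.comap (liftHom n)) (fun i hi h1 h2 => ?_) (mem_intervalPerms.1 hσ)
  rw [Subgroup.mem_comap, ← dswap_eq_liftHom]
  exact hH i hi h1 h2

theorem dswap_mem_genSpan {a b i : ℕ} (hi : i + 1 < n) (ha : a + 3 ≤ i) (h6 : 6 ≤ i)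
    (hb : i < b + 3) : dswap (⟨i, by omega⟩ : Fin n) ⟨i + 1, hi⟩ ∈ genSpan hn a b := by
  obtain ⟨i, rfl⟩ := Nat.exists_eq_add_of_le' (show 3 ≤ i by omega)
  have := twistedGen_mem_genSpan hn (show a ≤ i by omega) (show i < b by omega)
  rwa [twistedGen_of_ge hn (by omega) (by omega)] at this

theorem liftHom_mem_genSpan {a b : ℕ} (ha : 3 ≤ a) {σ : Equiv.Perm (Fin n)}
    (hσ : σ ∈ intervalPerms n (a + 3) (b + 3)) : liftHom n σ ∈ genSpan hn a b :=
  liftHom_mem_of_dswap_mem (fun _ hi h1 h2 => dswap_mem_genSpan hn hi h1 (by omega) h2) hσ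

/-- The second group consists of unsigned permutations and the first fixes the coordinate `b + 4`,
so a common element is an unsigned permutation not moving it. -/
theorem genSpan_inf_of_two_le {a b : ℕ} (ha : 2 ≤ a) (hb : b + 4 < n) :
    genSpan hn a b ⊓ genSpan hn (a + 1) (b + 1) ≤ genSpan hn (a + 1) b := by
  rintro g ⟨h1, h2⟩
  obtain ⟨σ, hσ, rfl⟩ := genSpan_le_map_liftHom hn (by omega) (by omega) h2
  apply liftHom_mem_genSpan hn (by omega)
  refine mem_intervalPerms_of_apply_eq (by omega) hσ ?_
  have : genSpan hn a b ≤ MulAction.stabilizer (Equiv.Perm (Fin n ⊕ Fin n))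
      (Sum.inl ⟨b + 3 + 1, by omega⟩ : Fin n ⊕ Fin n) :=
    genSpan_le hn fun i hi hib => MulAction.mem_stabilizer_iff.2
      (twistedGen_apply_of_lt hn (by omega) hib (by simp))
  simpa using MulAction.mem_stabilizer_iff.1 (this h1)

theorem eq_one_or_swap_of_mem_intervalPerms {p : ℕ} (hp : p + 1 < n) {σ : Equiv.Perm (Fin n)}
    (hσ : σ ∈ intervalPerms n p (p + 1)) :
    σ = 1 ∨ σ = Equiv.swap ⟨p, by omega⟩ ⟨p + 1, hp⟩ := by
  rw [mem_intervalPerms] at hσ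
  have hval : ∀ i : Fin n, p ≤ i → (i : ℕ) ≤ p + 1 → p ≤ σ i ∧ (σ i : ℕ) ≤ p + 1 := by
    intro i h1 h2
    by_contra h
    have := σ.injective (hσ (σ i) (by omega))
    rw [this] at h
    omega
  have h1 := hval ⟨p, by omega⟩ le_rfl (Nat.le_succ p)
  have h2 := hval ⟨p + 1, hp⟩ (Nat.le_succ p) le_rfl
  have hne : (σ ⟨p, by omega⟩ : ℕ) ≠ σ ⟨p + 1, hp⟩ := fun h => by
    simpa using σ.injective (Fin.ext h)
  have hcase : ∀ i : Fin n, (i : ℕ) ≠ p → (i : ℕ) ≠ p + 1 → σ i = i := fun i _ _ =>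
    hσ i (by omega)
  rcases eq_or_ne (σ ⟨p, by omega⟩ : ℕ) p with h | h
  · left
    ext i
    rcases eq_or_ne (i : ℕ) p with hi | hi
    · rw [show i = ⟨p, by omega⟩ from Fin.ext hi, h]; rfl
    rcases eq_or_ne (i : ℕ) (p + 1) with hi' | hi'
    · rw [show i = ⟨p + 1, by omega⟩ from Fin.ext hi']
      simp only [Equiv.Perm.coe_one, id]
      omega
    · rw [hcase i hi hi']; rfl
  · right
    ext i
    rcases eq_or_ne (i : ℕ) p with hi | hi
    · rw [show i = ⟨p, by omega⟩ from Fin.ext hi, Equiv.swap_apply_left]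
      simp only
      omega
    rcases eq_or_ne (i : ℕ) (p + 1) with hi' | hi'
    · rw [show i = ⟨p + 1, by omega⟩ from Fin.ext hi', Equiv.swap_apply_right]
      simp only
      omega
    · rw [hcase i hi hi', Equiv.swap_apply_of_ne_of_ne] <;> simpa [Fin.ext_iff]

theorem genSpan_le_blockHom :
    genSpan hn 0 3 ≤ ((detOne 7).comap (MonoidHom.fst _ _)).map
      (blockHom (show 7 ≤ n by omega)) := by
  refine genSpan_le hn fun i _ hi => ?_
  rw [twistedGen_block hn hi]
  exact Subgroup.mem_map_of_mem _ (blockGen_mem_detOne _)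

theorem dswap_notMem_genSpan {i j : ℕ} (hi : i < 7) (hj : j < 7) (hij : i ≠ j) :
    dswap (coord hn i) (coord hn j) ∉ genSpan hn 0 3 := by
  intro h
  obtain ⟨p, hp, hpe⟩ := genSpan_le_blockHom hn h
  rw [dswap_coord_eq_blockHom hn hi hj] at hpe
  rw [blockHom_injective (show 7 < n by omega) hpe] at hp
  exact dswap_notMem_detOne (by simpa using hij) hp

theorem eq_one_or_of_mem_closure_singleton {G : Type*} [Group G] {c g : G} (hc : c * c = 1)
    (hg : g ∈ Subgroup.closure {c}) : g = 1 ∨ g = c := by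
  rw [← Subgroup.zpowers_eq_closure] at hg
  obtain ⟨k, hk⟩ := hg
  obtain ⟨l, hl, h⟩ := eq_of_zpow_cases (N := 2) two_pos (show c ^ 2 = 1 by rw [sq, hc]) k
  rw [← hk, show (fun x : ℤ => c ^ x) k = c ^ l from h]
  interval_cases l <;> simp

theorem closure_singleton_inf_eq_bot {G : Type*} [Group G] {a b : G} (ha : a * a = 1)
    (hb : b * b = 1) (hab : a ≠ b) : Subgroup.closure {a} ⊓ Subgroup.closure {b} = ⊥ := by
  rw [eq_bot_iff]
  rintro g ⟨h1, h2⟩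
  rcases eq_one_or_of_mem_closure_singleton ha h1 with h | h
  · exact h
  · rcases eq_one_or_of_mem_closure_singleton hb h2 with h' | h'
    · exact h'
    · exact absurd (h.symm.trans h') hab

theorem genSpan_succ (a : ℕ) : genSpan hn a (a + 1) = Subgroup.closure {twistedGen hn a} := by
  have : Set.Ico a (a + 1) = {a} := by
    ext x
    simp only [Set.mem_Ico, Set.mem_singleton_iff]
    omega
  rw [genSpan, this, Set.image_singleton]

theorem genSpan_succ_succ (a : ℕ) :
    genSpan hn a (a + 2) = Subgroup.closure {twistedGen hn a, twistedGen hn (a + 1)} := by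
  have : Set.Ico a (a + 2) = {a, a + 1} := by
    ext x
    simp only [Set.mem_Ico, Set.mem_insert_iff, Set.mem_singleton_iff]
    omega
  rw [genSpan, this, Set.image_pair]

theorem twistedGen_mul_self (i : ℕ) : twistedGen hn i * twistedGen hn i = 1 := by
  by_cases h3 : i < 3
  · rw [twistedGen_block hn h3, ← map_mul, blockGen_mul_self, map_one]
  · by_cases hi : i + 4 < n
    · rw [twistedGen_of_ge hn (by omega) hi, dswap_mul_self]
    · rw [twistedGen, dif_neg h3, dif_neg hi, one_mul]

theorem blockGen_injective : Function.Injective blockGen := by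
  have : ∀ i j, blockGen i = blockGen j → i = j := by decide +kernel
  exact fun i j h => this i j h

theorem genSpan_inf_of_succ {a : ℕ} (ha : a < 2) :
    genSpan hn a (a + 1) ⊓ genSpan hn (a + 1) (a + 2) ≤ genSpan hn (a + 1) (a + 1) := by
  rw [genSpan_succ, genSpan_succ, closure_singleton_inf_eq_bot (twistedGen_mul_self hn _)
    (twistedGen_mul_self hn _)]
  · exact bot_le
  · rw [twistedGen_block hn (by omega), twistedGen_block hn (by omega)]
    exact fun h => by simpa using blockGen_injective (blockHom_injective (by omega) h)

theorem genSpan_two_inf :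
    genSpan hn 0 2 ⊓ genSpan hn 1 3 ≤ genSpan hn 1 2 := by
  have h7 : 7 < n := by omega
  have h := Subgroup.map_mono (f := blockHom h7.le) blockGen_closure_inf
  rw [Subgroup.map_inf _ _ _ (blockHom_injective h7), MonoidHom.map_closure,
    MonoidHom.map_closure, MonoidHom.map_closure, Set.image_pair, Set.image_pair,
    Set.image_singleton] at h
  rw [genSpan_succ_succ, genSpan_succ_succ, genSpan_succ, twistedGen_block hn (i := 0) (by norm_num),
    twistedGen_block hn (i := 0 + 1) (by norm_num), twistedGen_block hn (i := 1 + 1) (by norm_num)]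
  exact h

theorem dswap_one_two_commute {σ : Equiv.Perm (Fin n)} (hσ : σ ∈ intervalPerms n 4 n) :
    Commute (dswap (coord hn 1) (coord hn 2)) (liftHom n σ) := by
  refine (commute_of_conj ?_).symm
  rw [mem_intervalPerms] at hσ
  rw [conj_liftHom_dswap, hσ _ (by simp [coord]), hσ _ (by simp [coord])]

theorem pairSwap_commute {σ : Equiv.Perm (Fin n)} (hσ : σ ∈ intervalPerms n 4 n) :
    Commute (pairSwap hn) (liftHom n σ) := by
  have h1 := mem_intervalPerms.1 hσ
  refine (commute_of_conj ?_).symm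
  have h2 : liftHom n σ * negFrom n 5 * (liftHom n σ)⁻¹ = negFrom n 5 := by
    rw [mul_inv_eq_iff_eq_mul]
    have h3 : ∀ i : Fin n, 5 ≤ (i : ℕ) + 1 ↔ 5 ≤ (σ i : ℕ) + 1 := by
      intro i
      constructor
      · intro hi
        by_contra h
        have := σ.injective (h1 (σ i) (by omega))
        rw [this] at h
        exact h hi
      · intro hi
        by_contra h
        rw [h1 i (by omega)] at hi
        exact h hi
    ext1 x
    rcases x with x | x <;> by_cases hx : 5 ≤ (x : ℕ) + 1 <;>
      simp [negFrom_apply_inl, negFrom_apply_inr, hx, ← h3]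
  calc _ = (liftHom n σ * dswap (coord hn 0) (coord hn 1) * (liftHom n σ)⁻¹) *
        (liftHom n σ * dswap (coord hn 2) (coord hn 3) * (liftHom n σ)⁻¹) *
        (liftHom n σ * negFrom n 5 * (liftHom n σ)⁻¹) := by rw [pairSwap]; group
    _ = pairSwap hn := by
      rw [h2, conj_liftHom_dswap, conj_liftHom_dswap, h1 _ (by simp [coord]),
        h1 _ (by simp [coord]), h1 _ (by simp [coord]), h1 _ (by simp [coord])]
      rfl

end Spans

/-! ### Index two and generation, computed in the seven-coordinate block. -/

section Block

/-- The involution `d` normalises `B`, and all four listed generators lie in the coset of `d`; so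
`B` has index at most two in the group they generate. -/
theorem mem_closure_blockGen_of_mem {q : Equiv.Perm (Fin 7 ⊕ Fin 7) × ℤˣ}
    (hq : q ∈ Subgroup.closure {(dswap 0 1 * dswap 2 3 * negFrom 7 5, -1), (dswap 1 2, 1),
      (dswap 4 5, 1), (dswap 5 6, 1)}) :
    q ∈ Subgroup.closure {blockGen 1, blockGen 2} ∨
      (dswap 4 5, 1) * q ∈ Subgroup.closure {blockGen 1, blockGen 2} := by
  set B := Subgroup.closure {blockGen 1, blockGen 2}
  set d : Equiv.Perm (Fin 7 ⊕ Fin 7) × ℤˣ := (dswap 4 5, 1)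
  have hd : d * d = 1 := by decide +kernel
  have h1 : blockGen 1 ∈ B := Subgroup.subset_closure (by simp)
  have h2 : blockGen 2 ∈ B := Subgroup.subset_closure (by simp)
  -- The product is the 3-cycle `dswap 4 5 * dswap 5 6` times a commuting element of order 4, so its
  -- fourth power is that 3-cycle.
  have h4 : (blockGen 1 * blockGen 2) ^ 4 ∈ B := pow_mem (mul_mem h1 h2) _
  have hd' : d⁻¹ = d := inv_eq_of_mul_eq_one_right hd
  have hc1 : d * blockGen 1 * d = blockGen 1 := by decide +kernel
  have hc2 : d * blockGen 2 * d = (blockGen 1 * blockGen 2) ^ 4 * blockGen 2 *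
      ((blockGen 1 * blockGen 2) ^ 4)⁻¹ := by decide +kernel
  have hconj : ∀ b ∈ B, d * b * d ∈ B := by
    intro b hb
    have : B ≤ B.comap (MulAut.conj d).toMonoidHom := by
      rw [Subgroup.closure_le]
      rintro _ (rfl | rfl)
      · change d * blockGen 1 * d⁻¹ ∈ B
        rw [hd', hc1]
        exact h1
      · change d * blockGen 2 * d⁻¹ ∈ B
        rw [hd', hc2]
        exact mul_mem (mul_mem h4 h2) (inv_mem h4)
    have h : d * b * d⁻¹ ∈ B := this hb
    rwa [hd'] at h
  have hleft : ∀ s, s ∈ B ∨ d * s ∈ B → ∀ q, q ∈ B ∨ d * q ∈ B →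
      s * q ∈ B ∨ d * (s * q) ∈ B := by
    rintro s (hs | hs) q (hq | hq)
    · exact Or.inl (mul_mem hs hq)
    · refine Or.inr ?_
      have := mul_mem (hconj s hs) hq
      rwa [mul_assoc, ← mul_assoc d d, hd, one_mul, mul_assoc] at this
    · refine Or.inr ?_
      rw [← mul_assoc]
      exact mul_mem hs hq
    · refine Or.inl ?_
      have := mul_mem (hconj _ hs) hq
      rwa [← mul_assoc d d, hd, one_mul, mul_assoc, ← mul_assoc d d, hd, one_mul] at this
  have hgen : ∀ s ∈ ({(dswap 0 1 * dswap 2 3 * negFrom 7 5, -1), (dswap 1 2, 1), d,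
      (dswap 5 6, 1)} : Set (Equiv.Perm (Fin 7 ⊕ Fin 7) × ℤˣ)), s * s = 1 ∧ d * s ∈ B := by
    rintro s (rfl | rfl | rfl | rfl)
    · refine ⟨by decide +kernel, ?_⟩
      have hX : d * (dswap 0 1 * dswap 2 3 * negFrom 7 5, -1) = blockGen 1 := by decide +kernel
      rw [hX]
      exact h1
    · refine ⟨by decide +kernel, ?_⟩
      have h12 : d * (dswap 1 2, 1) = (blockGen 1 * blockGen 2) ^ 4 * blockGen 2 := by
        decide +kernel
      rw [h12]
      exact mul_mem h4 h2
    · exact ⟨hd, by rw [hd]; exact one_mem _⟩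
    · refine ⟨by decide +kernel, ?_⟩
      have h56 : d * (dswap 5 6, 1) = (blockGen 1 * blockGen 2) ^ 4 := by decide +kernel
      rw [h56]
      exact h4
  induction hq using Subgroup.closure_induction_left with
  | one => exact Or.inl (one_mem _)
  | mul_left s hs q _ ih => exact hleft s (Or.inr (hgen s hs).2) q ih
  | inv_mul_cancel s hs q _ ih =>
    rw [inv_eq_of_mul_eq_one_right (hgen s hs).1]
    exact hleft s (Or.inr (hgen s hs).2) q ih

theorem mem_of_blockGen_mem {H : Subgroup (Equiv.Perm (Fin 7 ⊕ Fin 7) × ℤˣ)}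
    (h0 : blockGen 0 ∈ H) (hX : (dswap 0 1 * dswap 2 3 * negFrom 7 5, -1) ∈ H)
    (h12 : (dswap 1 2, 1) ∈ H) (h45 : (dswap 4 5, 1) ∈ H) :
    (dswap 0 1, 1) ∈ H ∧ (dswap 2 3, 1) ∈ H ∧ (dswap 3 4, 1) ∈ H ∧ (negOne 3, 1) ∈ H := by
  have hq := mul_mem h12 h0
  -- The factor `(dswap 1 2, 1) * blockGen 0` is `dswap 3 4` with uniform signs from index 3 on.
  -- Dividing it by its conjugate under `dswap 4 5` cancels the signs and leaves a 3-cycle.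
  have h35 : (dswap 3 5, 1) ∈ H := by
    rw [show (dswap (3 : Fin 7) 5, (1 : ℤˣ)) = (dswap 1 2, 1) * blockGen 0 *
      ((dswap 4 5, 1) * ((dswap 1 2, 1) * blockGen 0) * (dswap 4 5, 1))⁻¹ * (dswap 4 5, 1) by
      decide +kernel]
    exact mul_mem (mul_mem hq (inv_mem (mul_mem (mul_mem h45 hq) h45))) h45
  have h34 : (dswap 3 4, 1) ∈ H := by
    rw [show (dswap (3 : Fin 7) 4, (1 : ℤˣ)) = (dswap 4 5, 1) * (dswap 3 5, 1) * (dswap 4 5, 1) by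
      decide +kernel]
    exact mul_mem (mul_mem h45 h35) h45
  -- The two long sign changes differ only at index 3, so this is `dswap 0 1 * dswap 2 3 * negOne
  -- 3`.
  have hZ := mul_mem hX (mul_mem h34 hq)
  have h04 : (dswap 0 4, 1) ∈ H := by
    rw [show (dswap (0 : Fin 7) 4, (1 : ℤˣ)) = (dswap 3 4, 1) *
      ((dswap 0 1 * dswap 2 3 * negFrom 7 5, -1) * (dswap 1 2, 1) *
        (dswap 0 1 * dswap 2 3 * negFrom 7 5, -1)) * (dswap 3 4, 1) by decide +kernel]
    exact mul_mem (mul_mem h34 (mul_mem (mul_mem hX h12) hX)) h34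
  have h14 : (dswap 1 4, 1) ∈ H := by
    rw [show (dswap (1 : Fin 7) 4, (1 : ℤˣ)) = (dswap 0 1 * dswap 2 3 * negFrom 7 5, -1) *
      ((dswap 3 4, 1) * ((dswap 1 2, 1) * blockGen 0)) * (dswap 0 4, 1) *
      ((dswap 0 1 * dswap 2 3 * negFrom 7 5, -1) *
      ((dswap 3 4, 1) * ((dswap 1 2, 1) * blockGen 0)))⁻¹ by decide +kernel]
    exact mul_mem (mul_mem hZ h04) (inv_mem hZ)
  have h01 : (dswap 0 1, 1) ∈ H := by
    rw [show (dswap (0 : Fin 7) 1, (1 : ℤˣ)) = (dswap 0 4, 1) * (dswap 1 4, 1) * (dswap 0 4, 1) by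
      decide +kernel]
    exact mul_mem (mul_mem h04 h14) h04
  have h13 : (dswap 1 3, 1) ∈ H := by
    rw [show (dswap (1 : Fin 7) 3, (1 : ℤˣ)) = (dswap 3 4, 1) * (dswap 1 4, 1) * (dswap 3 4, 1) by
      decide +kernel]
    exact mul_mem (mul_mem h34 h14) h34
  have h23 : (dswap 2 3, 1) ∈ H := by
    rw [show (dswap (2 : Fin 7) 3, (1 : ℤˣ)) = (dswap 1 3, 1) * (dswap 1 2, 1) * (dswap 1 3, 1) by
      decide +kernel]
    exact mul_mem (mul_mem h13 h12) h13
  refine ⟨h01, h23, h34, ?_⟩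
  rw [show (negOne (3 : Fin 7), (1 : ℤˣ)) = (dswap 0 1, 1) * (dswap 2 3, 1) *
    ((dswap 0 1 * dswap 2 3 * negFrom 7 5, -1) *
      ((dswap 3 4, 1) * ((dswap 1 2, 1) * blockGen 0))) by decide +kernel]
  exact mul_mem (mul_mem h01 h23) hZ

end Block

/-! ### Splitting the generators, intersections of consecutive strings, and generation of all signed
permutations. -/

section Spans

variable {n : ℕ} (hn : 8 ≤ n)

theorem Commute.mul_pow_three {G : Type*} [Group G] {x a b : G} (hx : x * x = 1) (ha : a * a = 1)
    (hb : b * b = 1) (h : a * b * a = b * a * b) (hc : Commute x (a * b)) :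
    (x * a * b) ^ 3 = x := by
  rw [mul_assoc, hc.mul_pow, mul_pow_three_of_braid ha hb h, mul_one, pow_succ, sq, hx, one_mul]

theorem dswap_braid {a b c : Fin n} (hab : a ≠ b) (hac : a ≠ c) (hbc : b ≠ c) :
    dswap a b * dswap b c * dswap a b = dswap b c * dswap a b * dswap b c := by
  rw [dswap_conj_dswap hac hbc, dswap_comm b c, dswap_comm a b,
    dswap_conj_dswap hac.symm hab.symm, dswap_comm]

/-- Cubing kills the 3-cycle on the indices 5, 6, 7 and preserves the commuting involution. -/
theorem twistedGen_two_mul_three_pow :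
    (twistedGen hn 2 * twistedGen hn 3) ^ 3 = dswap (coord hn 1) (coord hn 2) := by
  rw [twistedGen_two, twistedGen_of_ge hn le_rfl (by omega),
    Commute.mul_pow_three (dswap_mul_self _ _) (dswap_mul_self _ _) (dswap_mul_self _ _)]
  · apply dswap_braid <;> simp [coord]
  · apply Commute.mul_right <;> apply dswap_commute <;> simp [coord]

theorem dswap_one_two_mem_genSpan {b : ℕ} (hb : 4 ≤ b) :
    dswap (coord hn 1) (coord hn 2) ∈ genSpan hn 2 b := by
  rw [← twistedGen_two_mul_three_pow]
  exact pow_mem (mul_mem (twistedGen_mem_genSpan hn le_rfl (by omega))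
    (twistedGen_mem_genSpan hn (by norm_num) (by omega))) 3

theorem dswap_five_six_mem_genSpan {b : ℕ} (hb : 4 ≤ b) :
    dswap (coord hn 5) (coord hn 6) ∈ genSpan hn 2 b := by
  have h := mul_mem (dswap_one_two_mem_genSpan hn hb)
    (twistedGen_mem_genSpan hn le_rfl (show 2 < b by omega))
  rwa [twistedGen_two, ← mul_assoc, dswap_mul_self, one_mul] at h

theorem liftHom_mem_genSpan_two {b : ℕ} (hb : 4 ≤ b) {σ : Equiv.Perm (Fin n)}
    (hσ : σ ∈ intervalPerms n 5 (b + 3)) : liftHom n σ ∈ genSpan hn 2 b := by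
  refine liftHom_mem_of_dswap_mem (fun i hi h1 h2 => ?_) hσ
  rcases h1.eq_or_lt with rfl | h1
  · exact dswap_five_six_mem_genSpan hn hb
  · exact dswap_mem_genSpan hn hi h1.le h1 h2

theorem pairSwap_mul_self : pairSwap hn * pairSwap hn = 1 := by
  rw [pairSwap_eq_blockHom, ← map_mul,
    ← map_one (blockHom (show 7 ≤ n by omega))]
  congr 1
  decide +kernel

/-- The same cube trick, applied to `twistedGen hn 1` times `dswap` of the indices 5 and 6; the
latter is available from `b = 4` on. -/
theorem pairSwap_mem_genSpan {b : ℕ} (hb : 4 ≤ b) : pairSwap hn ∈ genSpan hn 1 b := by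
  have h := pow_mem (mul_mem (twistedGen_mem_genSpan hn le_rfl (show 1 < b by omega))
    (genSpan_mono hn one_le_two le_rfl (dswap_five_six_mem_genSpan hn hb))) 3
  rw [twistedGen_one] at h
  rwa [Commute.mul_pow_three (pairSwap_mul_self hn) (dswap_mul_self _ _) (dswap_mul_self _ _)] at h
  · apply dswap_braid <;> simp [coord]
  · rw [dswap_eq_liftHom, dswap_eq_liftHom, ← map_mul]
    refine pairSwap_commute hn (mul_mem (swap_mem_intervalPerms ?_ ?_ ?_ ?_)
      (swap_mem_intervalPerms ?_ ?_ ?_ ?_)) <;> simp only [coord] <;> omega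

theorem dswap_four_five_mem_genSpan {b : ℕ} (hb : 4 ≤ b) :
    dswap (coord hn 4) (coord hn 5) ∈ genSpan hn 1 b := by
  have h := mul_mem (pairSwap_mem_genSpan hn hb)
    (twistedGen_mem_genSpan hn le_rfl (show 1 < b by omega))
  rwa [twistedGen_one, ← mul_assoc, pairSwap_mul_self, one_mul] at h

theorem liftHom_mem_genSpan_one {b : ℕ} (hb : 4 ≤ b) {σ : Equiv.Perm (Fin n)}
    (hσ : σ ∈ intervalPerms n 4 (b + 3)) : liftHom n σ ∈ genSpan hn 1 b := by
  refine liftHom_mem_of_dswap_mem (fun i hi h1 h2 => ?_) hσ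
  rcases h1.eq_or_lt with rfl | h1
  · exact dswap_four_five_mem_genSpan hn hb
  rcases (show 5 ≤ i from h1).eq_or_lt with rfl | h1
  · exact genSpan_mono hn one_le_two le_rfl (dswap_five_six_mem_genSpan hn hb)
  · exact dswap_mem_genSpan hn hi (by omega) h1 h2

theorem exists_of_mem_genSpan_two {b : ℕ} (hb : 3 ≤ b) (hbn : b + 4 ≤ n)
    {g : Equiv.Perm (Fin n ⊕ Fin n)} (hg : g ∈ genSpan hn 2 b) :
    ∃ h ∈ Subgroup.closure {dswap (coord hn 1) (coord hn 2)},
      ∃ σ ∈ intervalPerms n 5 (b + 3), h * liftHom n σ = g := by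
  have hle : genSpan hn 2 b ≤ Subgroup.closure {dswap (coord hn 1) (coord hn 2)} ⊔
      (intervalPerms n 5 (b + 3)).map (liftHom n) := by
    refine genSpan_le hn fun i hi hib => ?_
    rcases hi.eq_or_lt with rfl | hi
    · rw [twistedGen_two, dswap_eq_liftHom (coord hn 5)]
      refine Subgroup.mul_mem_sup (Subgroup.subset_closure rfl)
        (Subgroup.mem_map_of_mem (liftHom n) (swap_mem_intervalPerms ?_ ?_ ?_ ?_)) <;>
        simp only [coord] <;> omega
    · rw [twistedGen_of_ge hn hi (by omega), dswap_eq_liftHom ⟨i + 3, _⟩]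
      refine Subgroup.mem_sup_right
        (Subgroup.mem_map_of_mem (liftHom n) (swap_mem_intervalPerms ?_ ?_ ?_ ?_)) <;>
        simp only <;> omega
  have hc : ∀ h ∈ Subgroup.closure {dswap (coord hn 1) (coord hn 2)},
      ∀ k ∈ (intervalPerms n 5 (b + 3)).map (liftHom n),
      Commute h k := by
    rintro h hh _ ⟨σ, hσ, rfl⟩
    refine commute_of_mem_closure (T := {liftHom n σ}) ?_ hh (Subgroup.subset_closure rfl)
    rintro _ rfl _ rfl
    exact dswap_one_two_commute hn (intervalPerms_mono (by norm_num) (by omega) hσ)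
  obtain ⟨h, hh, _, ⟨σ, hσ, rfl⟩, rfl⟩ := exists_mul_of_mem_sup_of_commute hc (hle hg)
  exact ⟨h, hh, σ, hσ, rfl⟩

/-- Only an upper bound: for `b = 3` not every such product lies in `genSpan hn 1 3`. -/
theorem exists_of_mem_genSpan_one {b : ℕ} (hb : 3 ≤ b) (hbn : b + 4 ≤ n)
    {g : Equiv.Perm (Fin n ⊕ Fin n)} (hg : g ∈ genSpan hn 1 b) :
    ∃ h ∈ Subgroup.closure {pairSwap hn, dswap (coord hn 1) (coord hn 2)},
      ∃ σ ∈ intervalPerms n 4 (b + 3), h * liftHom n σ = g := by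
  have hle : genSpan hn 1 b ≤
      Subgroup.closure {pairSwap hn, dswap (coord hn 1) (coord hn 2)} ⊔
        (intervalPerms n 4 (b + 3)).map (liftHom n) := by
    refine genSpan_le hn fun i hi hib => ?_
    rcases hi.eq_or_lt with rfl | hi
    · rw [twistedGen_one, dswap_eq_liftHom (coord hn 4)]
      refine Subgroup.mul_mem_sup (Subgroup.subset_closure (by simp))
        (Subgroup.mem_map_of_mem (liftHom n) (swap_mem_intervalPerms ?_ ?_ ?_ ?_)) <;>
        simp only [coord] <;> omega
    rcases (show 2 ≤ i from hi).eq_or_lt with rfl | hi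
    · rw [twistedGen_two, dswap_eq_liftHom (coord hn 5)]
      refine Subgroup.mul_mem_sup (Subgroup.subset_closure (by simp))
        (Subgroup.mem_map_of_mem (liftHom n) (swap_mem_intervalPerms ?_ ?_ ?_ ?_)) <;>
        simp only [coord] <;> omega
    · rw [twistedGen_of_ge hn hi (by omega), dswap_eq_liftHom ⟨i + 3, _⟩]
      refine Subgroup.mem_sup_right
        (Subgroup.mem_map_of_mem (liftHom n) (swap_mem_intervalPerms ?_ ?_ ?_ ?_)) <;>
        simp only <;> omega
  have hc : ∀ h ∈ Subgroup.closure {pairSwap hn, dswap (coord hn 1) (coord hn 2)},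
      ∀ k ∈ (intervalPerms n 4 (b + 3)).map (liftHom n),
      Commute h k := by
    rintro h hh _ ⟨σ, hσ, rfl⟩
    have hσ' := intervalPerms_mono (p' := 4) (q' := n) le_rfl (by omega) hσ
    refine commute_of_mem_closure (T := {liftHom n σ}) ?_ hh (Subgroup.subset_closure rfl)
    rintro _ (rfl | rfl) _ rfl
    · exact pairSwap_commute hn hσ'
    · exact dswap_one_two_commute hn hσ'
  obtain ⟨h, hh, _, ⟨σ, hσ, rfl⟩, rfl⟩ := exists_mul_of_mem_sup_of_commute hc (hle hg)
  exact ⟨h, hh, σ, hσ, rfl⟩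

theorem commute_negOne_of_mem_closure {i : Fin n} (hi : 4 ≤ (i : ℕ))
    {h : Equiv.Perm (Fin n ⊕ Fin n)}
    (hh : h ∈ Subgroup.closure {pairSwap hn, dswap (coord hn 1) (coord hn 2)}) :
    Commute h (negOne i) := by
  refine commute_of_mem_closure (T := {negOne i}) ?_ hh (Subgroup.subset_closure rfl)
  rintro _ (rfl | rfl) _ rfl
  · exact commute_negOne_of_apply (pairSwap_mem_signedPerms hn) (Or.inr (pairSwap_apply hn hi))
  · refine commute_negOne_of_apply (dswap_mem_signedPerms _ _) (Or.inl (dswap_apply_of_ne ?_ ?_)) <;>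
      simp only [coord, ne_eq, Fin.ext_iff] <;> omega

/-- Both `h` and the product preserve the axis of the coordinate `b + 4`, hence so does `σ`; being
unsigned, it fixes that coordinate. -/
theorem mem_intervalPerms_of_mul_mem_genSpan {b p : ℕ} (hb : 3 ≤ b) (hbn : b + 4 < n)
    {h : Equiv.Perm (Fin n ⊕ Fin n)}
    (hh : h ∈ Subgroup.closure {pairSwap hn, dswap (coord hn 1) (coord hn 2)})
    {σ : Equiv.Perm (Fin n)} (hσ : σ ∈ intervalPerms n p (b + 3 + 1))
    (hg : h * liftHom n σ ∈ genSpan hn 0 b) : σ ∈ intervalPerms n p (b + 3) := by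
  refine mem_intervalPerms_of_apply_eq (by omega) hσ (apply_eq_of_commute_negOne ?_)
  have h1 := commute_negOne_of_mem_genSpan hn hb (i := ⟨b + 3 + 1, hbn⟩) (by simp) hg
  have h2 := (commute_negOne_of_mem_closure hn (i := ⟨b + 3 + 1, hbn⟩) (by simp) hh).inv_left
  have := h2.mul_left h1
  rwa [inv_mul_cancel_left] at this

/-- For `b ≥ 4` both factors already lie in `genSpan hn 2 b`. For `b = 3` four candidates remain,
and the determinant excludes the two single transpositions. -/
theorem genSpan_inf_one {b : ℕ} (hb : 3 ≤ b) (hbn : b + 4 < n) :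
    genSpan hn 1 b ⊓ genSpan hn 2 (b + 1) ≤ genSpan hn 2 b := by
  rintro g ⟨h1, h2⟩
  obtain ⟨h, hh, σ, hσ, rfl⟩ := exists_of_mem_genSpan_two hn (by omega) (by omega) h2
  have h0 := genSpan_mono hn zero_le_one le_rfl h1
  have hσ' := mem_intervalPerms_of_mul_mem_genSpan hn hb hbn
    (Subgroup.closure_mono (by simp) hh) hσ h0
  rcases hb.eq_or_lt with rfl | hb
  · have hh' := eq_one_or_of_mem_closure_singleton (dswap_mul_self _ _) hh
    rcases hh' with rfl | rfl <;>
      rcases eq_one_or_swap_of_mem_intervalPerms (p := 5) (by omega) hσ' with rfl | rfl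
    · simp
    · rw [one_mul, ← dswap_eq_liftHom] at h0
      exact absurd h0 (dswap_notMem_genSpan hn (i := 5) (j := 6) (by norm_num) (by norm_num)
        (by norm_num))
    · rw [map_one, mul_one] at h0
      exact absurd h0 (dswap_notMem_genSpan hn (by norm_num) (by norm_num) (by norm_num))
    · rw [← dswap_eq_liftHom]
      have := twistedGen_mem_genSpan hn (le_refl 2) (show 2 < 3 by norm_num)
      rwa [twistedGen_two] at this
  · refine mul_mem ((Subgroup.closure_le _).2 ?_ hh) (liftHom_mem_genSpan_two hn hb hσ')
    rintro _ rfl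
    exact dswap_one_two_mem_genSpan hn hb

/-- For `b ≥ 4` the factors again lie in the smaller group. For `b = 3` that group has index at most
two in the bound, and the other coset would put a transposition into `genSpan hn 0 3`, against the
determinant. -/
theorem genSpan_inf_zero {b : ℕ} (hb : 3 ≤ b) (hbn : b + 4 < n) :
    genSpan hn 0 b ⊓ genSpan hn 1 (b + 1) ≤ genSpan hn 1 b := by
  rintro g ⟨h0, h1⟩
  obtain ⟨h, hh, σ, hσ, rfl⟩ := exists_of_mem_genSpan_one hn (by omega) (by omega) h1
  have hσ' := mem_intervalPerms_of_mul_mem_genSpan hn hb hbn hh hσ h0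
  rcases hb.eq_or_lt with rfl | hb
  · have h7 : 7 < n := by omega
    have hmem : h * liftHom n σ ∈ (Subgroup.closure
        {(dswap 0 1 * dswap 2 3 * negFrom 7 5, -1), (dswap 1 2, 1), (dswap 4 5, 1),
          (dswap 5 6, 1)}).map (blockHom h7.le) := by
      refine mul_mem ((Subgroup.closure_le _).2 ?_ hh) (liftHom_mem_of_dswap_mem ?_ hσ')
      · rintro _ (rfl | rfl)
        · rw [pairSwap_eq_blockHom]
          exact Subgroup.mem_map_of_mem _ (Subgroup.subset_closure (by simp))
        · rw [dswap_coord_eq_blockHom hn (by norm_num) (by norm_num)]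
          exact Subgroup.mem_map_of_mem _ (Subgroup.subset_closure (by simp))
      · intro i hi h4 h6
        have hi' : i = 4 ∨ i = 5 := by omega
        rcases hi' with rfl | rfl
        · exact ⟨(dswap 4 5, 1), Subgroup.subset_closure (by simp), blockHom_dswap _ _ _⟩
        · exact ⟨(dswap 5 6, 1), Subgroup.subset_closure (by simp), blockHom_dswap _ _ _⟩
    have hB : (Subgroup.closure {blockGen 1, blockGen 2}).map (blockHom h7.le) =
        genSpan hn 1 3 := by
      rw [genSpan_succ_succ, twistedGen_block hn (i := 1) (by norm_num),
        twistedGen_block hn (i := 1 + 1) (by norm_num), MonoidHom.map_closure, Set.image_pair]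
      rfl
    obtain ⟨q, hq, hqe⟩ := hmem
    rw [← hqe] at h0 ⊢
    rcases mem_closure_blockGen_of_mem hq with hq | hq
    · rw [← hB]
      exact Subgroup.mem_map_of_mem _ hq
    · exfalso
      have h2 := Subgroup.mem_map_of_mem (blockHom h7.le) hq
      rw [hB, map_mul, blockHom_dswap] at h2
      have h3 := genSpan_mono hn zero_le_one le_rfl h2
      rw [Subgroup.mul_mem_cancel_right _ h0] at h3
      exact dswap_notMem_genSpan hn (i := 4) (j := 5) (by norm_num) (by norm_num) (by norm_num) h3
  · refine mul_mem ((Subgroup.closure_le _).2 ?_ hh) (liftHom_mem_genSpan_one hn hb hσ')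
    rintro _ (rfl | rfl)
    · exact pairSwap_mem_genSpan hn hb
    · exact genSpan_mono hn one_le_two le_rfl (dswap_one_two_mem_genSpan hn hb)

theorem genSpan_inf_le {a b : ℕ} (hab : a < b) (hb : b + 4 < n) :
    genSpan hn a b ⊓ genSpan hn (a + 1) (b + 1) ≤ genSpan hn (a + 1) b := by
  by_cases ha : 2 ≤ a
  · exact genSpan_inf_of_two_le hn ha hb
  rcases (show a + 1 ≤ b from hab).eq_or_lt with rfl | hab
  · exact genSpan_inf_of_succ hn (by omega)
  interval_cases a
  · rcases (show 2 ≤ b from hab).eq_or_lt with rfl | hab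
    · exact genSpan_two_inf hn
    · exact genSpan_inf_zero hn hab hb
  · exact genSpan_inf_one hn hab hb

theorem twistedGen_commute {i j : ℕ} (hij : i + 2 ≤ j) :
    Commute (twistedGen hn i) (twistedGen hn j) := by
  by_cases hj3 : j < 3
  · obtain rfl : i = 0 := by omega
    obtain rfl : j = 2 := by omega
    rw [twistedGen_block hn (by norm_num), twistedGen_block hn (by norm_num)]
    refine Commute.map ?_ _
    show blockGen 0 * blockGen 2 = blockGen 2 * blockGen 0
    decide +kernel
  by_cases hj : j + 4 < n
  · rw [twistedGen_of_ge hn (by omega) hj]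
    refine commute_of_conj ?_
    by_cases hi : i < 2
    · interval_cases i
      · exact conj_dswap_of_neg (twistedGen_mem_signedPerms hn 0) (twistedGen_zero_apply hn (by simp; omega))
          (twistedGen_zero_apply hn (by simp; omega))
      · exact conj_dswap_of_neg (twistedGen_mem_signedPerms hn 1) (twistedGen_one_apply hn (by simp; omega))
          (twistedGen_one_apply hn (by simp; omega))
    · refine conj_dswap (twistedGen_mem_signedPerms hn i) ?_ ?_
      · rcases (show 2 ≤ i by omega).eq_or_lt with rfl | hi
        · rw [twistedGen_two, Equiv.Perm.mul_apply, dswap_apply_of_ne, dswap_apply_of_ne] <;>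
            simp only [coord, ne_eq, Fin.ext_iff] <;> omega
        · rw [twistedGen_of_ge hn hi (by omega), dswap_apply_of_ne] <;>
            simp only [ne_eq, Fin.ext_iff] <;> omega
      · rcases (show 2 ≤ i by omega).eq_or_lt with rfl | hi
        · rw [twistedGen_two, Equiv.Perm.mul_apply, dswap_apply_of_ne, dswap_apply_of_ne] <;>
            simp only [coord, ne_eq, Fin.ext_iff] <;> omega
        · rw [twistedGen_of_ge hn hi (by omega), dswap_apply_of_ne] <;>
            simp only [ne_eq, Fin.ext_iff] <;> omega
  · rw [show twistedGen hn j = 1 by rw [twistedGen, dif_neg hj3, dif_neg hj]]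
    exact Commute.one_right _

theorem closure_twistedGen_inf (J K : Set ℕ) (hJ : J ⊆ Set.Iio (n - 4))
    (hK : K ⊆ Set.Iio (n - 4)) :
    Subgroup.closure (twistedGen hn '' J) ⊓ Subgroup.closure (twistedGen hn '' K) ≤
      Subgroup.closure (twistedGen hn '' (J ∩ K)) := by
  have h : Set.Iio (n - 4) = Set.Ico 0 (n - 4) := by
    ext x
    simp
  rw [h] at hJ hK
  exact closure_image_inf_le_of_closure_Ico (m := n - 4) (fun i j => twistedGen_commute hn)
    (fun a b hab hb => genSpan_inf_le hn hab (by omega)) (n - 4) 0 (n - 4) le_rfl (by omega) J K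
    hJ hK

/-- The string from generator 1 on gives the unsigned permutations from index 4 on; the block
computation adds the remaining adjacent transpositions and one sign change. -/
theorem signedPerms_le_genSpan : signedPerms n ≤ genSpan hn 0 (n - 4) := by
  have h1 := genSpan_mono hn zero_le_one (le_refl (n - 4))
  have h2 := genSpan_mono hn (Nat.zero_le 2) (le_refl (n - 4))
  have hb : 4 ≤ n - 4 := by omega
  have h7 : 7 ≤ n := by omega
  have h12 := h2 (dswap_one_two_mem_genSpan hn hb)
  have hX := h1 (pairSwap_mem_genSpan hn hb)
  have h45 := h1 (dswap_four_five_mem_genSpan hn hb)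
  have h0 := twistedGen_mem_genSpan hn (le_refl 0) (show 0 < n - 4 by omega)
  rw [dswap_coord_eq_blockHom hn (by norm_num) (by norm_num)] at h12 h45
  rw [pairSwap_eq_blockHom] at hX
  rw [twistedGen_block hn (by norm_num)] at h0
  obtain ⟨h01, h23, h34, h3⟩ := mem_of_blockGen_mem
    (H := (genSpan hn 0 (n - 4)).comap (blockHom h7)) h0 hX h12 h45
  rw [Subgroup.mem_comap, blockHom_dswap] at h01 h23 h34
  rw [Subgroup.mem_comap, blockHom_negOne] at h3
  rw [blockHom_dswap] at h12
  refine fun g hg => signedPerm_mem_of_negOne_mem (fun σ => ?_) h3 hg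
  refine liftHom_mem_of_dswap_mem (p := 0) (q := n) (fun i hi _ _ => ?_)
    (mem_intervalPerms.2 fun i hi => by have := i.2; omega)
  by_cases h4 : 4 ≤ i
  · rw [dswap_eq_liftHom]
    refine h1 (liftHom_mem_genSpan_one hn hb (swap_mem_intervalPerms ?_ ?_ ?_ ?_)) <;>
      simp only <;> omega
  · interval_cases i
    exacts [h01, h12, h23, h34]

end Spans

/-! ### The C-string -/

section Main

variable {n : ℕ}

/-! ### Normal subgroups of the group of signed permutations. -/

theorem signedPerm_ext {g h : Equiv.Perm (Fin n ⊕ Fin n)} (hg : g ∈ signedPerms n)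
    (hh : h ∈ signedPerms n) (H : ∀ i, g (Sum.inl i) = h (Sum.inl i)) : g = h := by
  ext1 x
  rcases x with i | i
  · exact H i
  · rw [apply_inr_of_mem_signedPerms hg, apply_inr_of_mem_signedPerms hh, H]

theorem exists_perm_apply_eq {α : Type*} [DecidableEq α] {a b c d : α} (hab : a ≠ b)
    (hcd : c ≠ d) : ∃ σ : Equiv.Perm α, σ a = c ∧ σ b = d := by
  refine ⟨Equiv.swap (Equiv.swap a c b) d * Equiv.swap a c, ?_, ?_⟩
  · rw [Equiv.Perm.mul_apply, Equiv.swap_apply_left, Equiv.swap_apply_of_ne_of_ne _ hcd]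
    intro h
    exact hab ((Equiv.swap a c).injective ((Equiv.swap_apply_left a c).trans h))
  · rw [Equiv.Perm.mul_apply, Equiv.swap_apply_left]

theorem liftHom_injective : Function.Injective (liftHom n) := fun σ τ h => by
  ext i
  simpa [Fin.ext_iff] using congrArg (fun g : Equiv.Perm (Fin n ⊕ Fin n) => g (Sum.inl i)) h

theorem dswap_ne_one {a b : Fin n} (hab : a ≠ b) : dswap a b ≠ 1 := by
  rw [dswap_eq_liftHom, Ne, map_eq_one_iff _ liftHom_injective, Equiv.swap_eq_one_iff]
  exact hab

theorem dswap_mem_of_dswap_mem {M : Subgroup (Equiv.Perm (Fin n ⊕ Fin n))}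
    (hM : ∀ s ∈ signedPerms n, ∀ g ∈ M, s * g * s⁻¹ ∈ M) {a b c d : Fin n} (hab : a ≠ b)
    (hcd : c ≠ d) (h : dswap a b ∈ M) : dswap c d ∈ M := by
  obtain ⟨σ, rfl, rfl⟩ := exists_perm_apply_eq hab hcd
  rw [← conj_liftHom_dswap]
  exact hM _ (liftHom_mem_signedPerms σ) _ h

theorem negOne_mul_negOne_mem {M : Subgroup (Equiv.Perm (Fin n ⊕ Fin n))}
    (hM : ∀ s ∈ signedPerms n, ∀ g ∈ M, s * g * s⁻¹ ∈ M) {i j : Fin n} (hij : i ≠ j)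
    (h : negOne i * negOne j ∈ M) (a b : Fin n) : negOne a * negOne b ∈ M := by
  rcases eq_or_ne a b with rfl | hab
  · rw [negOne_mul_self]
    exact one_mem M
  obtain ⟨σ, rfl, rfl⟩ := exists_perm_apply_eq hij hab
  have hs := liftHom_mem_signedPerms σ
  rw [← conj_negOne hs (Or.inl (liftHom_apply_inl σ i)),
    ← conj_negOne hs (Or.inl (liftHom_apply_inl σ j))]
  have := hM _ hs _ h
  rwa [show liftHom n σ * (negOne i * negOne j) * (liftHom n σ)⁻¹ = liftHom n σ * negOne i *
    (liftHom n σ)⁻¹ * (liftHom n σ * negOne j * (liftHom n σ)⁻¹) by group] at this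

/-- Modulo `M` all single sign changes agree with `e`, so -1 agrees with `e ^ n`, which is 1 for
even `n`. -/
theorem sumComm_mem_of_negOne_mul_negOne_mem {M : Subgroup (Equiv.Perm (Fin n ⊕ Fin n))}
    (hn : Even n) (h : ∀ a b : Fin n, negOne a * negOne b ∈ M) :
    Equiv.sumComm (Fin n) (Fin n) ∈ M := by
  rcases Nat.eq_zero_or_pos n with rfl | h0
  · rw [Subsingleton.elim (Equiv.sumComm (Fin 0) (Fin 0)) 1]
    exact one_mem M
  let e : Equiv.Perm (Fin n ⊕ Fin n) := negOne ⟨0, h0⟩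
  have key : ∀ S : Finset (Fin n), negSet S * e ^ S.card ∈ M := by
    intro S
    induction S using Finset.induction_on with
    | empty =>
      rw [negSet_empty, Finset.card_empty, pow_zero, one_mul]
      exact one_mem M
    | insert a S ha ih =>
      have hc : Commute (negSet S) e := by
        simp only [e]
        rw [negOne_eq_negSet]
        exact negSet_commute _ _
      rw [negSet_insert ha, Finset.card_insert_of_notMem ha, pow_succ', mul_assoc,
        ← mul_assoc (negSet S), hc.eq, mul_assoc, ← mul_assoc]
      exact mul_mem (h a _) ih
  have hu := key Finset.univ
  have he : ∀ m, Even m → e ^ m = 1 := by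
    rintro _ ⟨k, rfl⟩
    rw [← two_mul, pow_mul, sq, negOne_mul_self, one_pow]
  rwa [negSet_univ, Finset.card_univ, Fintype.card_fin, he n hn, mul_one] at hu

/-- For even `n`, every non-trivial normal subgroup of the group of signed permutations contains
`-1`. -/
theorem sumComm_mem_of_normal {M : Subgroup (Equiv.Perm (Fin n ⊕ Fin n))}
    (hM : ∀ s ∈ signedPerms n, ∀ g ∈ M, s * g * s⁻¹ ∈ M) (hle : M ≤ signedPerms n)
    (hbot : M ≠ ⊥) (hn : Even n) : Equiv.sumComm (Fin n) (Fin n) ∈ M := by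
  obtain ⟨g, hgM, hg1⟩ := M.bot_or_exists_ne_one.resolve_left hbot
  have hgs := hle hgM
  by_cases hmove : ∃ i j, i ≠ j ∧ (g (Sum.inl i) = Sum.inl j ∨ g (Sum.inl i) = Sum.inr j)
  · obtain ⟨i, j, hij, h⟩ := hmove
    refine sumComm_mem_of_negOne_mul_negOne_mem hn (negOne_mul_negOne_mem hM hij.symm ?_)
    -- The commutator of `g` and `negOne i` is `negOne j * negOne i`.
    have h1 := mul_mem hgM (hM _ (negOne_mem_signedPerms i) _ (inv_mem hgM))
    rwa [show g * (negOne i * g⁻¹ * (negOne i)⁻¹) = g * negOne i * g⁻¹ * (negOne i)⁻¹ by group,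
      conj_negOne hgs h, negOne_inv] at h1
  · push Not at hmove
    have hdiag : ∀ i, g (Sum.inl i) = Sum.inl i ∨ g (Sum.inl i) = Sum.inr i := by
      intro i
      rcases h : g (Sum.inl i) with j | j
      · by_contra hne
        have hij : i ≠ j := fun hij => hne (Or.inl (by rw [hij]))
        exact (hmove i j hij).1 h
      · by_contra hne
        have hij : i ≠ j := fun hij => hne (Or.inr (by rw [hij]))
        exact (hmove i j hij).2 h
    by_cases hall : ∀ j, g (Sum.inl j) = Sum.inr j
    · rwa [← signedPerm_ext hgs (Subgroup.mem_centralizer_singleton_iff.2 rfl) hall]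
    push Not at hall
    obtain ⟨j, hj⟩ := hall
    replace hj := (hdiag j).resolve_right hj
    obtain ⟨i, hi⟩ : ∃ i, g (Sum.inl i) = Sum.inr i := by
      by_contra hne
      push Not at hne
      exact hg1 (signedPerm_ext hgs (one_mem _) fun i => (hdiag i).resolve_right (hne i))
    have hij : i ≠ j := by
      rintro rfl
      simp [hj] at hi
    refine sumComm_mem_of_negOne_mul_negOne_mem hn (negOne_mul_negOne_mem hM hij ?_)
    -- Here `g` is diagonal with opposite signs at `i` and `j`; in the product with its conjugate
    -- all signs cancel except those at `i` and `j`.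
    have h1 := mul_mem (hM _ (dswap_mem_signedPerms i j) _ hgM) hgM
    rw [dswap_inv] at h1
    convert h1 using 1
    refine signedPerm_ext (mul_mem (negOne_mem_signedPerms _) (negOne_mem_signedPerms _))
      (hle h1) fun x => ?_
    have hjr := apply_inr_of_mem_signedPerms hgs j
    have hir := apply_inr_of_mem_signedPerms hgs i
    rcases eq_or_ne x i with rfl | hxi
    · simp [negOne_eq_negSet, negSet_apply, hij, hi, hjr, hj]
    rcases eq_or_ne x j with rfl | hxj
    · simp [negOne_eq_negSet, negSet_apply, hij.symm, hi, hj]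
    · have hxr := apply_inr_of_mem_signedPerms hgs x
      rcases hdiag x with h | h <;>
        simp [negOne_eq_negSet, negSet_apply, hxi, hxj, h, hxr, Equiv.swap_apply_of_ne_of_ne hxi hxj]

/-! ### Transfer to the Coxeter group: C-string, Schläfli symbol and quotients. -/

variable (hn : 8 ≤ n)

theorem twistedGen_eq_conj_tPerm (i : Fin (n - 4)) :
    twistedGen hn i = negOne (coord hn 4) * tPerm n hn i * (negOne (coord hn 4))⁻¹ := by
  have h7 : 7 ≤ n := by omega
  have h4 : negOne (coord hn 4) = blockHom h7 (negOne 4, 1) := (blockHom_negOne h7 4).symm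
  obtain ⟨i, hi⟩ := i
  rw [negOne_inv]
  by_cases h3 : i < 3
  · rw [twistedGen_block hn h3, h4]
    interval_cases i
    · rw [show tPerm n hn ⟨0, hi⟩ = blockHom h7 (dswap 1 2, 1) * blockHom h7 (dswap 3 4, 1) *
        blockHom h7 (negFrom 7 6, -1) by
        rw [blockHom_dswap, blockHom_dswap, blockHom_negFrom h7 6 (by norm_num)]; rfl]
      simp only [← map_mul]
      congr 1
      clear h4 h7
      decide +revert +kernel
    · rw [show tPerm n hn ⟨1, hi⟩ = blockHom h7 (dswap 0 1, 1) * blockHom h7 (dswap 2 3, 1) *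
        blockHom h7 (dswap 4 5, 1) * blockHom h7 (negFrom 7 7, -1) by
        rw [blockHom_dswap, blockHom_dswap, blockHom_dswap,
          blockHom_negFrom h7 7 (by norm_num)]; rfl]
      simp only [← map_mul]
      congr 1
      clear h4 h7
      decide +revert +kernel
    · rw [show tPerm n hn ⟨2, hi⟩ = blockHom h7 (dswap 1 2, 1) * blockHom h7 (dswap 5 6, 1) by
        rw [blockHom_dswap, blockHom_dswap]; rfl]
      simp only [← map_mul]
      congr 1
      clear h4 h7
      decide +revert +kernel
  · have ht : tPerm n hn ⟨i, hi⟩ = dswap ⟨i + 3, by omega⟩ ⟨i + 4, by omega⟩ := by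
      rw [tPerm, if_neg (by simp only; omega), if_neg (by simp only; omega),
        if_neg (by simp only; omega)]
      rfl
    rw [twistedGen_of_ge hn (show 3 ≤ i by omega) (show i + 4 < n by omega), ht]
    have hc : Commute (dswap (⟨i + 3, by omega⟩ : Fin n) ⟨i + 4, by omega⟩)
        (negOne (coord hn 4)) := by
      refine commute_negOne_of_apply (dswap_mem_signedPerms _ _) (Or.inl (dswap_apply_of_ne ?_ ?_)) <;>
        simp only [coord, ne_eq, Fin.ext_iff] <;> omega
    rw [← hc.eq, mul_assoc, negOne_mul_self, mul_one]

theorem tPerm_mem_signedPerms (i : Fin (n - 4)) : tPerm n hn i ∈ signedPerms n := by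
  have h := twistedGen_mem_signedPerms hn i
  rw [twistedGen_eq_conj_tPerm] at h
  have hc := negOne_mem_signedPerms (coord hn 4)
  rwa [Subgroup.mul_mem_cancel_right _ (inv_mem hc), Subgroup.mul_mem_cancel_left _ hc] at h

/-- The representation by signed permutations, conjugated by the sign change of the fifth
coordinate. -/
noncomputable def twistedRep : (CoxeterMatrix.B n).Group →* Equiv.Perm (Fin n ⊕ Fin n) :=
  (MulAut.conj (negOne (coord hn 4))).toMonoidHom.comp (signedRep n)

theorem twistedRep_apply (g : (CoxeterMatrix.B n).Group) :
    twistedRep hn g = negOne (coord hn 4) * signedRep n g * (negOne (coord hn 4))⁻¹ := rfl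

theorem twistedRep_injective : Function.Injective (twistedRep hn) :=
  (MulAut.conj (negOne (coord hn 4))).injective.comp (signedRep_injective n)

theorem twistedRep_mem_signedPerms (g : (CoxeterMatrix.B n).Group) :
    twistedRep hn g ∈ signedPerms n :=
  mul_mem (mul_mem (negOne_mem_signedPerms _) (signedRep_mem_signedPerms g))
    (inv_mem (negOne_mem_signedPerms _))

theorem exists_twistedRep_eq {s : Equiv.Perm (Fin n ⊕ Fin n)} (hs : s ∈ signedPerms n) :
    ∃ g, twistedRep hn g = s := by
  have hc := negOne_mem_signedPerms (coord hn 4)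
  obtain ⟨g, hg⟩ := mem_range_signedRep (by omega) (mul_mem (mul_mem (inv_mem hc) hs) hc)
  refine ⟨g, ?_⟩
  rw [twistedRep_apply, hg]
  group

theorem twistedGen_ne_one {i : ℕ} (hi : i + 4 < n) : twistedGen hn i ≠ 1 := by
  by_cases h3 : i < 3
  · rw [twistedGen_block hn h3, Ne, map_eq_one_iff _ (blockHom_injective (by omega))]
    have : ∀ j, blockGen j ≠ 1 := by decide +kernel
    exact this _
  · rw [twistedGen_of_ge hn (by omega) hi]
    exact dswap_ne_one (by simp)

variable {t : Fin (n - 4) → (CoxeterMatrix.B n).Group}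

theorem image_twistedRep (ht : ∀ i, twistedRep hn (t i) = twistedGen hn i) (J : Set (Fin (n - 4))) :
    twistedRep hn '' (t '' J) = twistedGen hn '' (Fin.val '' J) := by
  rw [Set.image_image, Set.image_image]
  exact Set.image_congr fun i _ => ht i

theorem closure_inf_closure_of_twistedRep (ht : ∀ i, twistedRep hn (t i) = twistedGen hn i)
    (J K : Set (Fin (n - 4))) :
    Subgroup.closure (t '' J) ⊓ Subgroup.closure (t '' K) = Subgroup.closure (t '' (J ∩ K)) := by
  refine le_antisymm ?_ (le_inf
    (Subgroup.closure_mono (Set.image_mono Set.inter_subset_left))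
    (Subgroup.closure_mono (Set.image_mono Set.inter_subset_right)))
  rw [← Subgroup.map_le_map_iff_of_injective (twistedRep_injective hn),
    Subgroup.map_inf _ _ _ (twistedRep_injective hn), MonoidHom.map_closure, MonoidHom.map_closure,
    MonoidHom.map_closure, image_twistedRep hn ht, image_twistedRep hn ht, image_twistedRep hn ht,
    Set.image_inter Fin.val_injective]
  apply closure_twistedGen_inf hn <;>
  · rintro _ ⟨i, -, rfl⟩
    exact i.2

theorem isCString_of_twistedRep (ht : ∀ i, twistedRep hn (t i) = twistedGen hn i) :
    IsCString t := by
  have hinj := twistedRep_injective hn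
  have hne : ∀ i, t i ≠ 1 := fun i h => by
    have := ht i
    rw [h, map_one] at this
    exact twistedGen_ne_one hn (by have := i.2; omega) this.symm
  refine ⟨fun i j hij => ?_, fun i => ?_, ?_, fun i j hij => ?_,
    closure_inf_closure_of_twistedRep hn ht⟩
  -- Equal generators with different indices would, by the intersection property for two singletons,
  -- generate the trivial group.
  · by_contra hne'
    have h := closure_inf_closure_of_twistedRep hn ht {i} {j}
    have hd : ({i} ∩ {j} : Set (Fin (n - 4))) = ∅ := by
      simpa using Ne.symm hne'
    rw [hd, Set.image_empty, Subgroup.closure_empty, Set.image_singleton, Set.image_singleton,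
      ← hij, inf_idem, ← Subgroup.zpowers_eq_closure,
      Subgroup.zpowers_eq_bot] at h
    exact hne i h
  · refine orderOf_eq_prime ?_ (hne i)
    apply hinj
    rw [map_pow, ht, sq, twistedGen_mul_self, map_one]
  · rw [eq_top_iff]
    intro g _
    rw [← Set.image_univ]
    have h := signedPerms_le_genSpan hn (twistedRep_mem_signedPerms hn g)
    have hI : Set.Ico 0 (n - 4) = Fin.val '' (Set.univ : Set (Fin (n - 4))) := by
      ext x
      simp
    rw [genSpan, hI, ← image_twistedRep hn ht, ← MonoidHom.map_closure,
      Subgroup.mem_map_iff_mem hinj] at h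
    exact h
  · apply hinj
    rw [map_mul, map_mul, ht, ht]
    exact twistedGen_commute hn hij

theorem orderOf_dswap_mul_dswap {a b c : Fin n} (hab : a ≠ b) (hac : a ≠ c) (hbc : b ≠ c) :
    orderOf (dswap a b * dswap b c) = 3 := by
  rw [dswap_eq_liftHom, dswap_eq_liftHom, ← map_mul, orderOf_injective _ liftHom_injective,
    Equiv.swap_comm a b]
  exact (Equiv.Perm.isThreeCycle_swap_mul_swap_same hab.symm hbc hac).orderOf

theorem orderOf_twistedGen_mul_of_lt_two {i : ℕ} (hi : i < 2) :
    orderOf (twistedGen hn i * twistedGen hn (i + 1)) = 12 := by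
  rw [twistedGen_block hn (by omega), twistedGen_block hn (by omega), ← map_mul,
    orderOf_injective _ (blockHom_injective (by omega)), orderOf_eq_iff (by norm_num)]
  interval_cases i
  · refine ⟨show (blockGen 0 * blockGen 1) ^ 12 = 1 by decide +kernel, ?_⟩
    have : ∀ m : Fin 12, 0 < (m : ℕ) → (blockGen 0 * blockGen 1) ^ (m : ℕ) ≠ 1 := by
      decide +kernel
    exact fun m h1 h2 => this ⟨m, h1⟩ h2
  · refine ⟨show (blockGen 1 * blockGen 2) ^ 12 = 1 by decide +kernel, ?_⟩
    have : ∀ m : Fin 12, 0 < (m : ℕ) → (blockGen 1 * blockGen 2) ^ (m : ℕ) ≠ 1 := by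
      decide +kernel
    exact fun m h1 h2 => this ⟨m, h1⟩ h2

theorem orderOf_twistedGen_two_mul_three :
    orderOf (twistedGen hn 2 * twistedGen hn 3) = 6 := by
  rw [twistedGen_two, twistedGen_of_ge hn le_rfl (by omega), mul_assoc]
  have h1 : orderOf (dswap (coord hn 1) (coord hn 2)) = 2 :=
    orderOf_eq_prime (by rw [sq, dswap_mul_self]) (dswap_ne_one (by simp [coord]))
  have h2 : orderOf (dswap (coord hn 5) (coord hn 6) * dswap (⟨3 + 3, by omega⟩ : Fin n)
      ⟨3 + 4, by omega⟩) = 3 :=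
    orderOf_dswap_mul_dswap (by simp [coord]) (by simp [coord]) (by simp [coord])
  rw [Commute.orderOf_mul_eq_mul_orderOf_of_coprime, h1, h2]
  · apply Commute.mul_right <;> apply dswap_commute <;> simp [coord]
  · rw [h1, h2]
    norm_num

theorem schlafliSymbol_of_twistedRep (ht : ∀ i, twistedRep hn (t i) = twistedGen hn i) :
    schlafliSymbol t = 12 :: 12 :: 6 :: List.replicate (n - 8) 3 := by
  have horder : ∀ i (hi : i + 1 < n - 4), orderOf (t ⟨i, by omega⟩ * t ⟨i + 1, hi⟩) =
      orderOf (twistedGen hn i * twistedGen hn (i + 1)) := by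
    intro i hi
    rw [← orderOf_injective _ (twistedRep_injective hn), map_mul, ht, ht]
  apply List.ext_getElem
  · simp only [schlafliSymbol, List.length_ofFn, List.length_cons, List.length_replicate]
    omega
  · intro i h1 h2
    have hi : i + 1 < n - 4 := by
      simp only [schlafliSymbol, List.length_ofFn] at h1
      omega
    simp only [schlafliSymbol, List.getElem_ofFn, horder i hi]
    rcases i with _ | _ | _ | i
    · exact orderOf_twistedGen_mul_of_lt_two hn (by norm_num)
    · exact orderOf_twistedGen_mul_of_lt_two hn (by norm_num)
    · exact orderOf_twistedGen_two_mul_three hn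
    · rw [twistedGen_of_ge hn (by omega) (by omega), twistedGen_of_ge hn (by omega) (by omega)]
      simp only [List.getElem_cons_succ, List.getElem_replicate]
      exact orderOf_dswap_mul_dswap (by simp) (by simp) (by simp)

theorem not_isCString_quotient (ht : ∀ i, twistedRep hn (t i) = twistedGen hn i) (he : Even n)
    (N : Subgroup (CoxeterMatrix.B n).Group) [N.Normal] (hN : N ≠ ⊥) :
    ¬ IsCString (fun i => (t i : (CoxeterMatrix.B n).Group ⧸ N)) := by
  intro hC
  have hinj := twistedRep_injective hn
  have h7 : 7 ≤ n := by omega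
  set M := N.map (twistedRep hn)
  have hM : ∀ s ∈ signedPerms n, ∀ g ∈ M, s * g * s⁻¹ ∈ M := by
    rintro s hs _ ⟨g, hg, rfl⟩
    obtain ⟨x, rfl⟩ := exists_twistedRep_eq hn hs
    rw [← map_inv, ← map_mul, ← map_mul]
    exact Subgroup.mem_map_of_mem _ (Subgroup.Normal.conj_mem inferInstance g hg x)
  have hMle : M ≤ signedPerms n := by
    rintro _ ⟨g, -, rfl⟩
    exact twistedRep_mem_signedPerms hn g
  have hMbot : M ≠ ⊥ := by
    rwa [Ne, Subgroup.map_eq_bot_iff_of_injective _ hinj]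
  obtain ⟨z, hz, hz1⟩ := sumComm_mem_of_normal hM hMle hMbot he
  have hlt : ∀ i, i < 4 → i < n - 4 := fun i hi => by omega
  let i₀ : Fin (n - 4) := ⟨0, hlt 0 (by norm_num)⟩
  let i₁ : Fin (n - 4) := ⟨1, hlt 1 (by norm_num)⟩
  let i₂ : Fin (n - 4) := ⟨2, hlt 2 (by norm_num)⟩
  let i₃ : Fin (n - 4) := ⟨3, hlt 3 (by norm_num)⟩
  let y := (t i₂ * t i₃) ^ 3
  have hy : twistedRep hn y = dswap (coord hn 1) (coord hn 2) := by
    rw [map_pow, map_mul, ht, ht]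
    exact twistedGen_two_mul_three_pow hn
  let w := (t i₁ * t i₂ * t i₀) ^ 4 * (t i₁ * t i₀) ^ 2 * (t i₁ * t i₂ * t i₀) ^ 3 * t i₁ *
    t i₀ * t i₁
  have hw : w = y * z := by
    apply hinj
    have h0 : twistedRep hn (t i₀) = blockHom h7 (blockGen 0) := ht i₀
    have h1 : twistedRep hn (t i₁) = blockHom h7 (blockGen 1) := ht i₁
    have h2 : twistedRep hn (t i₂) = blockHom h7 (blockGen 2) := ht i₂
    rw [map_mul _ y z, hy, hz1]
    simp only [w, map_mul, map_pow, h0, h1, h2]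
    simp only [← map_mul, ← map_pow]
    rw [blockGen_word, show (dswap 1 2 * negFrom 7 1, (-1 : ℤˣ)) =
      (dswap (1 : Fin 7) 2, (1 : ℤˣ)) * (negFrom 7 1, -1) from rfl, map_mul, blockHom_dswap,
      blockHom_negFrom h7 1 (by norm_num), negFrom_one]
    rfl
  let q := QuotientGroup.mk' N
  have hqt : ∀ (J : Set (Fin (n - 4))) (i), i ∈ J → q (t i) ∈ Subgroup.closure
      ((fun i => (t i : (CoxeterMatrix.B n).Group ⧸ N)) '' J) :=
    fun J i hi => Subgroup.subset_closure ⟨i, hi, rfl⟩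
  have hmem : q y ∈ Subgroup.closure
      ((fun i => (t i : (CoxeterMatrix.B n).Group ⧸ N)) '' {i₂}) := by
    -- Modulo `N` the element `y` equals the word `w` in the generators 0, 1, 2, and by definition
    -- it is a word in the generators 2, 3.
    rw [show ({i₂} : Set (Fin (n - 4))) = {i₀, i₁, i₂} ∩ {i₂, i₃} by
      ext x
      simp only [Set.mem_singleton_iff, Set.mem_inter_iff, Set.mem_insert_iff, Fin.ext_iff, i₀, i₁,
        i₂, i₃]
      omega, ← hC.intersection, Subgroup.mem_inf]
    constructor
    · have hqw : q y = q w := by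
        rw [hw, map_mul, show q z = 1 from (QuotientGroup.eq_one_iff z).2 hz, mul_one]
      have h0 := hqt {i₀, i₁, i₂} i₀ (by simp)
      have h1 := hqt {i₀, i₁, i₂} i₁ (by simp)
      have h2 := hqt {i₀, i₁, i₂} i₂ (by simp)
      rw [hqw]
      simp only [w, map_mul, map_pow]
      exact mul_mem (mul_mem (mul_mem (mul_mem (mul_mem (pow_mem (mul_mem (mul_mem h1 h2) h0) _)
        (pow_mem (mul_mem h1 h0) _)) (pow_mem (mul_mem (mul_mem h1 h2) h0) _)) h1) h0) h1
    · simp only [y, map_mul, map_pow]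
      exact pow_mem (mul_mem (hqt _ _ (by simp)) (hqt _ _ (by simp))) _
  rw [Set.image_singleton] at hmem
  have hsq : (t i₂ : (CoxeterMatrix.B n).Group ⧸ N) * t i₂ = 1 := by
    rw [← sq, ← hC.involution i₂, pow_orderOf_eq_one]
  -- Either `y` itself lies in `N`, or `y⁻¹ * t i₂` does; both are transpositions, as `t i₂` is `y`
  -- times a second transposition.
  have hd : ∃ a b : Fin n, a ≠ b ∧ dswap a b ∈ M := by
    rcases eq_one_or_of_mem_closure_singleton hsq hmem with h | h
    · refine ⟨coord hn 1, coord hn 2, by simp [coord], ?_⟩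
      rw [← hy]
      exact Subgroup.mem_map_of_mem _ ((QuotientGroup.eq_one_iff y).1 h)
    · refine ⟨coord hn 5, coord hn 6, by simp [coord], ?_⟩
      have h' := Subgroup.mem_map_of_mem (twistedRep hn) (QuotientGroup.eq.1 h)
      rw [map_mul, map_inv, hy, ht, show ((i₂ : Fin (n - 4)) : ℕ) = 2 from rfl, twistedGen_two,
        inv_mul_cancel_left] at h'
      exact h'
  obtain ⟨a, b, hab, hd⟩ := hd
  -- All transpositions are conjugate, so `t i₃` lies in `N` and its image has order 1 instead of 2.
  have h3 := dswap_mem_of_dswap_mem hM hab (c := ⟨3 + 3, by omega⟩) (d := ⟨3 + 4, by omega⟩)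
    (by simp) hd
  rw [← twistedGen_of_ge hn le_rfl, ← ht i₃, Subgroup.mem_map_iff_mem hinj] at h3
  have h4 := hC.involution i₃
  rw [(QuotientGroup.eq_one_iff (t i₃)).2 h3, orderOf_one] at h4
  exact absurd h4 (by norm_num)

end Main

theorem theorem1p3 (n : ℕ) (hn : 8 ≤ n) :
    ∃ ρ : (CoxeterMatrix.B n).Group →* Equiv.Perm (Fin n ⊕ Fin n),
      Function.Injective ρ ∧
      (∀ j : Fin n, ρ ((CoxeterMatrix.B n).simple j.rev) = betaPerm j) ∧
      ∃ t : Fin (n - 4) → (CoxeterMatrix.B n).Group,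
        (∀ i, ρ (t i) = tPerm n hn i) ∧
        IsCString t ∧
        schlafliSymbol t = 12 :: 12 :: 6 :: List.replicate (n - 8) 3 ∧
        (Even n → IsUnravelledCString t) := by
  refine ⟨signedRep n, signedRep_injective n, signedRep_simple, ?_⟩
  choose t ht using fun i => mem_range_signedRep (by omega) (tPerm_mem_signedPerms hn i)
  have ht' : ∀ i, twistedRep hn (t i) = twistedGen hn i := fun i => by
    rw [twistedRep_apply, ht, twistedGen_eq_conj_tPerm]
  have hC := isCString_of_twistedRep hn ht'
  refine ⟨t, ht, hC, schlafliSymbol_of_twistedRep hn ht', fun he => ⟨hC, fun N _ hN _ => ?_⟩⟩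
  have hNC := not_isCString_quotient hn ht' he N hN
  by_cases hinj : Function.Injective fun i => (t i : (CoxeterMatrix.B n).Group ⧸ N)
  · exact Or.inr ⟨hinj, hNC⟩
  · exact Or.inl hinj
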